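/- Let $[X:\mathcal R]$ be a presentation of an inverse monoid $M$, where $\mathcal R$ is a set of pairs of words over $A=X\sqcup X^{-1}$. Let $\rho:A^*\to \mathrm{FIM}(X)$ be the natural map onto the free inverse monoid, let $\theta:\mathrm{FIM}(X)\to M$ be the (surjective) presentation map, and let $E(\cdot)$ denote the set of idempotents. Let $\theta_{\min}$ be the congruence on $\mathrm{FIM}(X)$ in which $a$ and $b$ are related if and only if there is an idempotent $f$ with $af=bf$ and $(a^{-1}a)\theta=f\theta=(b^{-1}b)\theta$. Put $\mathcal T=\mathcal T(M,X)=\mathrm{FIM}(X)/\theta_{\min}$, with quotient map $\tau:\mathrm{FIM}(X)\to\mathcal T$, and let $\psi:\mathcal T\to M$ be the induced idempotent separating homomorphism, so that $\theta=\tau\psi$ (maps are written on the right). For $e\in E(M)$ let $\tilde e$ be the unique idempotent of $\mathcal T$ with $\tilde e\psi=e$, and let $K_e=\{k\in\mathcal T: k\psi=e\}$, a group with identity $\tilde e$. A (Lausch) $M$-module consists of a presheaf of abelian groups $(A_e)_{e\in E(M)}$ over the semilattice $E(M)$, with structure maps $\alpha^e_f:A_e\to A_f$ for $f\le e$, and a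 map $(a,s)\mapsto a\lhd s$ from $\big(\bigsqcup_e A_e\big)\times M$ to $\bigsqcup_e A_e$ such that, with $a\oplus b=a\alpha^e_{ef}+b\alpha^f_{ef}$ for $a\in A_e$, $b\in A_f$, one has $(a\oplus b)\lhd s=(a\lhd s)\oplus(b\lhd s)$, $a\lhd st=(a\lhd s)\lhd t$, $a\lhd e=a\oplus 0_e$ and $0_e\lhd s=0_{s^{-1}es}$ for all $s,t\in M$ and $e\in E(M)$. An isomorphism of $M$-modules is a family of group isomorphisms $A_e\to B_e$ $(e\in E(M))$ that commutes with the structure maps and with the actions of $M$. The relation module of the presentation is the $M$-module $\mathcal K=\bigsqcup_{e\in E(M)}K_e^{ab}$, whose structure maps are induced by $k\mapsto k\tilde f$ and whose action is induced by conjugation: the class of $k\in K_e$ is sent by $s\in M$ to the class of $t^{-1}kt$ in $K_{s^{-1}es}^{ab}$, for any $t\in\mathcal T$ with $t\psi=s$. The left Schützenberger graph of $(M,X)$ has vertex set $M$ and, for $x\in X$ and $s\in M$ with $(x^{-1}x)\theta\ge ss^{-1}$, an edge $(x,s)$ labelled $x$ from $s$ to $(x\theta)s$. For $e\in E(M)$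 the component $\mathrm{Sch}(M,X,e)$ that contains $e$ has as vertex set the $\mathcal L$-class $L_e=\{s\in M:s^{-1}s=e\}$. Let $\pi_e$ be its fundamental group at $e$, and let $H_1(\mathrm{Sch}(M,X,e))$ be its first homology group, that is, the kernel of the boundary map $(x,s)\mapsto (x\theta)s-s$ from the free abelian group on its edges to the free abelian group on its vertices. Then $\mathcal H=\bigsqcup_{e\in E(M)}H_1(\mathrm{Sch}(M,X,e))$ is an $M$-module, with structure maps induced by $(x,s)\mapsto(x,sf)$ and action induced by $(x,s)\lhd t=(x,st)$. Theorem. There are group isomorphisms $\kappa_e:\pi_e\to K_e$ $(e\in E(M))$ such that, for every closed edge path at $e$ with label $w\in A^*$ (the letters in the order in which they are read along the path) and reverse word $\overleftarrow{w}$, the homotopy class $[w]$ of the path satisfies $$[w]\kappa_e=\big((\overleftarrow{w}\rho\tau)\,\tilde e\big)^{-1},$$ and there is an isomorphism of $M$-modules $\mathcal H\to\mathcal K$ whose component at each $e\in E(M)$ sends the homology class of every closed edge path at $e$ with label $w$ to the class of $[w]\kappa_e$ in $K_e^{ab}$. In particular the relation module $\mathcal K$ and the $M$-module $\mathcal H$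 are isomorphic. -/

import Mathlib

noncomputable section

namespace InvMon

universe u v w w₁ w₂

/-! ### Inverse monoids -/

/-- An inverse monoid: every `a` has exactly one `b` with `a b a = a` and `b a b = b`,
and this `b` is denoted `a⁻¹`. -/
class InverseMonoid (S : Type u) extends Monoid S, Inv S where
  mul_inv_mul : ∀ a : S, a * a⁻¹ * a = a
  inv_mul_inv : ∀ a : S, a⁻¹ * a * a⁻¹ = a⁻¹
  inv_unique : ∀ a b : S, a * b * a = a → b * a * b = b → b = a⁻¹

section Basic

variable {S : Type u} [InverseMonoid S]

theorem mim (a : S) : a * (a⁻¹ * a) = a := by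
  rw [← mul_assoc]; exact InverseMonoid.mul_inv_mul a

theorem imi (a : S) : a⁻¹ * (a * a⁻¹) = a⁻¹ := by
  rw [← mul_assoc]; exact InverseMonoid.inv_mul_inv a

theorem mim_assoc (a b : S) : a * (a⁻¹ * (a * b)) = a * b := by
  rw [← mul_assoc a⁻¹, ← mul_assoc, mim]

theorem imi_assoc (a b : S) : a⁻¹ * (a * (a⁻¹ * b)) = a⁻¹ * b := by
  rw [← mul_assoc a, ← mul_assoc, imi]

theorem inv_eq_of {a b : S} (h₁ : a * (b * a) = a) (h₂ : b * (a * b) = b) : a⁻¹ = b :=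
  (InverseMonoid.inv_unique a b (by rw [mul_assoc, h₁]) (by rw [mul_assoc, h₂])).symm

theorem idem_inv {e : S} (he : IsIdempotentElem e) : e⁻¹ = e :=
  inv_eq_of (by rw [he.eq, he.eq]) (by rw [he.eq, he.eq])

theorem inv_inv_eq (a : S) : a⁻¹⁻¹ = a := inv_eq_of (imi a) (mim a)

theorem idem_assoc {e : S} (he : IsIdempotentElem e) (a : S) : e * (e * a) = e * a := by
  rw [← mul_assoc, he.eq]

theorem idem_mul {e f : S} (he : IsIdempotentElem e) (hf : IsIdempotentElem f) :
    IsIdempotentElem (e * f) := by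
  have h1 := mim (e * f)
  have h2 := imi (e * f)
  have hx : (e * f)⁻¹ = f * ((e * f)⁻¹ * e) := by
    apply inv_eq_of
    · simp only [mul_assoc, idem_assoc he, idem_assoc hf] at h1 ⊢
      exact h1
    · have h3 := congrArg (fun z => f * (z * e)) h2
      simp only [mul_assoc, idem_assoc he, idem_assoc hf] at h3 ⊢
      exact h3
  have hxi : IsIdempotentElem (e * f)⁻¹ := by
    have h3 := congrArg (fun z => f * (z * e)) h2
    have : (e * f)⁻¹ * (e * f)⁻¹ = (f * ((e * f)⁻¹ * e)) * (f * ((e * f)⁻¹ * e)) := by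
      rw [← hx]
    rw [IsIdempotentElem, this]
    simp only [mul_assoc] at h3 ⊢
    rw [h3, ← hx]
  have : e * f = (e * f)⁻¹ := by
    rw [← idem_inv hxi, inv_inv_eq]
  rw [this]; exact hxi

theorem idem_comm {e f : S} (he : IsIdempotentElem e) (hf : IsIdempotentElem f) :
    e * f = f * e := by
  have h1 := (idem_mul he hf).eq
  have h2 := (idem_mul hf he).eq
  rw [← idem_inv (idem_mul he hf)]
  apply inv_eq_of
  · simp only [mul_assoc, idem_assoc he, idem_assoc hf] at h1 ⊢
    exact h1
  · simp only [mul_assoc, idem_assoc he, idem_assoc hf] at h2 ⊢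
    exact h2

theorem idem_inv_mul (a : S) : IsIdempotentElem (a⁻¹ * a) := by
  rw [IsIdempotentElem, mul_assoc, mim]

theorem idem_mul_inv (a : S) : IsIdempotentElem (a * a⁻¹) := by
  rw [IsIdempotentElem, mul_assoc, imi]

theorem mul_inv_rev_eq (a b : S) : (a * b)⁻¹ = b⁻¹ * a⁻¹ := by
  have hc := idem_comm (idem_mul_inv b) (idem_inv_mul a)
  simp only [mul_assoc] at hc
  apply inv_eq_of
  · have h := congrArg (fun z => a * (z * b)) hc
    simp only [mul_assoc, mim_assoc] at h ⊢
    rw [h, mim]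
  · have h := congrArg (fun z => b⁻¹ * (z * a⁻¹)) hc
    simp only [mul_assoc, imi_assoc] at h ⊢
    rw [← h, imi]

theorem idem_conj {e : S} (he : IsIdempotentElem e) (s : S) :
    IsIdempotentElem (s⁻¹ * e * s) := by
  have hc := congrArg (fun z => s⁻¹ * (z * s)) (congrArg (e * ·) (idem_comm (idem_mul_inv s) he))
  simp only [mul_assoc, idem_assoc he] at hc
  rw [IsIdempotentElem]
  simp only [mul_assoc]
  rw [hc, mim]

theorem map_inv_eq {T : Type v} [InverseMonoid T] (φ : S →* T) (a : S) : φ a⁻¹ = (φ a)⁻¹ := by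
  symm
  apply inv_eq_of
  · rw [← map_mul, ← map_mul, mim]
  · rw [← map_mul, ← map_mul, imi]

/-- The natural partial order: `a ≤ b` if and only if `a = b f` for some idempotent `f`. -/
def NatLE (a b : S) : Prop := ∃ f : S, IsIdempotentElem f ∧ a = b * f

theorem natLE_iff {a b : S} : NatLE a b ↔ b * (a⁻¹ * a) = a := by
  constructor
  · rintro ⟨f, hf, rfl⟩
    have h := idem_comm hf (idem_inv_mul b)
    have h2 := congrArg (fun z => b * (z * f)) h
    simp only [mul_assoc, mim_assoc, hf.eq] at h2
    rw [mul_inv_rev_eq, idem_inv hf]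
    simp only [mul_assoc, h2]
  · intro h
    exact ⟨_, idem_inv_mul a, h.symm⟩

theorem natLE_refl (a : S) : NatLE a a := natLE_iff.2 (mim a)

theorem natLE_trans {a b c : S} : NatLE a b → NatLE b c → NatLE a c := by
  rintro ⟨f, hf, rfl⟩ ⟨g, hg, rfl⟩
  exact ⟨g * f, idem_mul hg hf, mul_assoc _ _ _⟩

theorem mul_idem_eq {f : S} (hf : IsIdempotentElem f) (c : S) :
    f * c = c * (c⁻¹ * f * c) := by
  have h := congrArg (· * c) (idem_comm hf (idem_mul_inv c))
  simp only [mul_assoc, mim] at h ⊢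
  exact h

theorem natLE_mul {a b c d : S} : NatLE a b → NatLE c d → NatLE (a * c) (b * d) := by
  rintro ⟨f, hf, rfl⟩ ⟨g, hg, rfl⟩
  refine ⟨_, idem_mul (idem_conj hf d) hg, ?_⟩
  have := congrArg (fun z => b * (z * g)) (mul_idem_eq hf d)
  simp only [mul_assoc] at this ⊢
  exact this

theorem natLE_inv {a b : S} : NatLE a b → NatLE a⁻¹ b⁻¹ := by
  rintro ⟨f, hf, rfl⟩
  refine ⟨_, idem_conj hf b⁻¹, ?_⟩
  rw [mul_inv_rev_eq, idem_inv hf]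
  exact mul_idem_eq hf _

/-- A monoid with a unary operation `⁻¹` satisfying the usual identities and in which the elements
`a a⁻¹` commute is an inverse monoid. -/
abbrev InverseMonoid.ofStar (S : Type u) [Monoid S] [Inv S]
    (h₁ : ∀ a : S, a * a⁻¹ * a = a) (h₂ : ∀ a : S, a⁻¹⁻¹ = a)
    (h₃ : ∀ a b : S, (a * b)⁻¹ = b⁻¹ * a⁻¹)
    (h₄ : ∀ a b : S, a * a⁻¹ * (b * b⁻¹) = b * b⁻¹ * (a * a⁻¹)) : InverseMonoid S where
  mul_inv_mul := h₁
  inv_mul_inv := fun a => by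
    have h := h₁ a⁻¹
    rwa [h₂] at h
  inv_unique := by
    have h₁r : ∀ a : S, a⁻¹ * a * a⁻¹ = a⁻¹ := fun a => by
      have h := h₁ a⁻¹
      rwa [h₂] at h
    have hs : ∀ e : S, e * e = e → e * e⁻¹ = e := by
      intro e he
      have hs' : e⁻¹ * e⁻¹ = e⁻¹ := by rw [← h₃, he]
      have h5 : e⁻¹ = e * e⁻¹ * (e⁻¹ * e) := by
        calc e⁻¹ = e⁻¹ * (e * e) * e⁻¹ := by rw [he, h₁r]
          _ = e⁻¹ * e⁻¹⁻¹ * (e * e⁻¹) := by rw [h₂]; simp only [mul_assoc]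
          _ = _ := by rw [h₄, h₂]
      have h6 : e⁻¹ = e := by
        calc e⁻¹ = e * (e⁻¹ * e⁻¹) * e := h5.trans (by simp only [mul_assoc])
          _ = e := by rw [hs', h₁]
      rw [h6, he]
    have hc : ∀ e f : S, e * e = e → f * f = f → e * f = f * e := by
      intro e f he hf
      rw [← hs e he, ← hs f hf, h₄]
    intro a b hab hba
    have e1 : b * a * (b * a) = b * a := by rw [← mul_assoc, hba]
    have e2 : a⁻¹ * a * (a⁻¹ * a) = a⁻¹ * a := by rw [← mul_assoc, h₁r]
    have e3 : a * b * (a * b) = a * b := by rw [← mul_assoc, hab]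
    have e4 : a * a⁻¹ * (a * a⁻¹) = a * a⁻¹ := by rw [← mul_assoc, h₁]
    calc b = b * (a * a⁻¹ * a) * b := by rw [h₁, hba]
      _ = (b * a) * (a⁻¹ * a) * b := by simp only [mul_assoc]
      _ = (a⁻¹ * a) * (b * a) * b := by rw [hc _ _ e1 e2]
      _ = a⁻¹ * a * b := by rw [mul_assoc, hba]
      _ = a⁻¹ * (a * a⁻¹ * a) * b := by rw [h₁]
      _ = a⁻¹ * ((a * a⁻¹) * (a * b)) := by simp only [mul_assoc]
      _ = a⁻¹ * ((a * b) * (a * a⁻¹)) := by rw [hc _ _ e4 e3]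
      _ = a⁻¹ * (a * b * a) * a⁻¹ := by simp only [mul_assoc]
      _ = a⁻¹ := by rw [hab, h₁r]

/-- The set of idempotents of an inverse monoid. -/
@[ext]
structure Idem (S : Type u) [InverseMonoid S] : Type u where
  val : S
  idem : IsIdempotentElem val

/-- `E(S)` is a meet semilattice: `e ⊓ f = e f`, and `e ≤ f` if and only if `e f = e`. -/
instance : SemilatticeInf (Idem S) where
  le e f := e.1 * f.1 = e.1
  inf e f := ⟨e.1 * f.1, idem_mul e.2 f.2⟩
  le_refl e := e.2.eq
  le_trans e f g h₁ h₂ := by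
    rw [← h₁, mul_assoc, h₂]
  le_antisymm e f h₁ h₂ := by
    apply Idem.ext
    rw [← h₁, idem_comm e.2 f.2, h₂]
  inf_le_left e f := by
    change e.1 * f.1 * e.1 = e.1 * f.1
    rw [idem_comm e.2 f.2, mul_assoc, e.2.eq]
  inf_le_right e f := by
    change e.1 * f.1 * f.1 = e.1 * f.1
    rw [mul_assoc, f.2.eq]
  le_inf e f g h₁ h₂ := by
    change e.1 * (f.1 * g.1) = e.1
    rw [← mul_assoc, h₁, h₂]

theorem Idem.le_def {e f : Idem S} : e ≤ f ↔ e.1 * f.1 = e.1 := Iff.rfl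

theorem Idem.inf_val (e f : Idem S) : (e ⊓ f).1 = e.1 * f.1 := rfl

/-- The idempotent `s⁻¹ e s`. -/
def Idem.conj (e : Idem S) (s : S) : Idem S := ⟨s⁻¹ * e.1 * s, idem_conj e.2 s⟩

theorem Idem.conj_val (e : Idem S) (s : S) : (e.conj s).1 = s⁻¹ * e.1 * s := rfl

theorem Idem.conj_mul (e : Idem S) (s t : S) : e.conj (s * t) = (e.conj s).conj t := by
  apply Idem.ext
  simp only [Idem.conj_val, mul_inv_rev_eq, mul_assoc]

theorem Idem.conj_idem (e f : Idem S) : e.conj f.1 = e ⊓ f := by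
  apply Idem.ext
  rw [Idem.conj_val, Idem.inf_val, idem_inv f.2, ← idem_comm e.2 f.2, mul_assoc, f.2.eq]

theorem Idem.conj_of_le {e f : Idem S} (h : f ≤ e) : e.conj f.1 = f := by
  rw [Idem.conj_idem, inf_eq_right.2 h]

theorem Idem.conj_inf (e f : Idem S) (s : S) : (e ⊓ f).conj s = e.conj s ⊓ f.conj s := by
  apply Idem.ext
  simp only [Idem.conj_val, Idem.inf_val]
  have hc := congrArg (fun z => s⁻¹ * (e.1 * (z * s))) (idem_comm (idem_mul_inv s) f.2)
  simp only [mul_assoc, mim] at hc ⊢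
  exact hc.symm

end Basic

/-! ### Modules over an inverse monoid -/

/-- The operation `a ⊕ b = a α^e_{ef} + b α^f_{ef}` (for `a ∈ A_e`, `b ∈ A_f`) on the disjoint union
of a presheaf of abelian groups over `E(S)`. -/
def oplus {S : Type u} [InverseMonoid S] {A : Idem S → Type w} [∀ e, AddCommGroup (A e)]
    (res : ∀ {e f : Idem S}, f ≤ e → A e →+ A f) (a b : Σ e, A e) : Σ e, A e :=
  ⟨a.1 ⊓ b.1, res inf_le_left a.2 + res inf_le_right b.2⟩

/-- An `S`-module in the sense of Lausch: a presheaf of abelian groups `A_e` over `E(S)`, together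
with a map `(a, s) ↦ a ⊲ s` on the disjoint union of the `A_e`, satisfying four axioms. -/
structure LauschModule (S : Type u) [InverseMonoid S] where
  A : Idem S → Type w
  [grp : ∀ e, AddCommGroup (A e)]
  res : ∀ {e f : Idem S}, f ≤ e → A e →+ A f
  res_self : ∀ (e : Idem S) (a : A e), res (le_refl e) a = a
  res_res : ∀ {e f g : Idem S} (h₁ : f ≤ e) (h₂ : g ≤ f) (a : A e),
    res h₂ (res h₁ a) = res (h₂.trans h₁) a
  act : (Σ e, A e) → S → Σ e, A e
  oplus_act : ∀ (a b : Σ e, A e) (s : S),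
    act (oplus res a b) s = oplus res (act a s) (act b s)
  act_mul : ∀ (a : Σ e, A e) (s t : S), act a (s * t) = act (act a s) t
  act_idem : ∀ (a : Σ e, A e) (e : Idem S), act a e.1 = oplus res a ⟨e, 0⟩
  zero_act : ∀ (e : Idem S) (s : S), act ⟨e, 0⟩ s = ⟨e.conj s, 0⟩

attribute [instance] LauschModule.grp

/-- An isomorphism of `S`-modules: group isomorphisms `A_e ≃ B_e` that commute with the structure
maps of the presheaves and with the actions of `S`. -/
structure LauschModule.Iso {S : Type u} [InverseMonoid S]
    (A : LauschModule.{u, w₁} S) (B : LauschModule.{u, w₂} S) where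
  equiv : ∀ e : Idem S, A.A e ≃+ B.A e
  map_res : ∀ {e f : Idem S} (h : f ≤ e) (a : A.A e),
    equiv f (A.res h a) = B.res h (equiv e a)
  map_act : ∀ (e : Idem S) (a : A.A e) (s : S),
    (⟨(A.act ⟨e, a⟩ s).1, equiv _ (A.act ⟨e, a⟩ s).2⟩ : Σ e, B.A e) = B.act ⟨e, equiv e a⟩ s

section OfShift

variable {S : Type u} [InverseMonoid S] {A : Idem S → Type w} [∀ e, AddCommGroup (A e)]
  (shift : ∀ {e e' : Idem S} (s : S), e.conj s = e' → A e →+ A e')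

/-- Construction of an `S`-module from homomorphisms `A_e → A_{s⁻¹es}`, functorial in `s`: the
action of `s` is given by these maps, and the structure map `A_e → A_f` for `f ≤ e` is the map
given by `f`, as `f⁻¹ef = f`. -/
def LauschModule.ofShift
    (shift_self : ∀ (e : Idem S) (h : e.conj e.1 = e) (a : A e), shift e.1 h a = a)
    (shift_shift : ∀ {e e' e'' : Idem S} (s t : S) (h : e.conj s = e') (h' : e'.conj t = e'')
      (h'' : e.conj (s * t) = e'') (a : A e), shift t h' (shift s h a) = shift (s * t) h'' a) :
    LauschModule.{u, w} S :=
  have key : ∀ {e e' : Idem S} (s t : S) (h : e.conj s = e') (h' : e.conj t = e') (a : A e),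
      e.1 * s = e.1 * t → shift s h a = shift t h' a := by
    intro e e' s t h h' a hst
    have h0 : e.conj e.1 = e := Idem.conj_of_le le_rfl
    have hs : e.conj (e.1 * s) = e' := by rw [Idem.conj_mul, h0, h]
    have ht : e.conj (e.1 * t) = e' := by rw [Idem.conj_mul, h0, h']
    have h1 := shift_shift e.1 s h0 h hs a
    have h2 := shift_shift e.1 t h0 h' ht a
    rw [shift_self] at h1 h2
    rw [h1, h2]
    congr 2
  have sig : ∀ {e e' : Idem S} (h : e = e') (hc : e.conj e.1 = e') (a : A e) (b : A e'),
      shift e.1 hc a = b → (⟨e, a⟩ : Σ e, A e) = ⟨e', b⟩ := by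
    intro e e' h hc a b hab
    subst h
    rw [shift_self] at hab
    rw [hab]
  { A := A
    res := fun {_ f} h => shift f.1 (Idem.conj_of_le h)
    res_self := fun e a => shift_self e _ a
    res_res := by
      intro e f g h₁ h₂ a
      have hgf : g.1 * f.1 = g.1 := h₂
      have hfg : f.1 * g.1 = g.1 := by rw [idem_comm f.2 g.2, hgf]
      have h3 : e.conj (f.1 * g.1) = g := by rw [hfg]; exact Idem.conj_of_le (h₂.trans h₁)
      rw [shift_shift _ _ _ _ h3]
      apply key
      rw [hfg]
    act := fun a s => ⟨a.1.conj s, shift s rfl a.2⟩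
    oplus_act := by
      rintro ⟨e, a⟩ ⟨f, b⟩ s
      have hE := Idem.conj_inf e f s
      refine sig hE (by rw [Idem.conj_of_le le_rfl, hE]) _ _ ?_
      have P : ∀ (g : Idem S) (hg : e ⊓ f ≤ g) (c : A g)
          (h1 : ((e ⊓ f).conj s).conj ((e ⊓ f).conj s).1 = e.conj s ⊓ f.conj s)
          (h2 : g.conj (e ⊓ f).1 = e ⊓ f)
          (h3 : (g.conj s).conj (e.conj s ⊓ f.conj s).1 = e.conj s ⊓ f.conj s),
          shift ((e ⊓ f).conj s).1 h1 (shift s rfl (shift (e ⊓ f).1 h2 c)) =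
            shift (e.conj s ⊓ f.conj s).1 h3 (shift s rfl c) := by
        intro g hg c h1 h2 h3
        have k1 : g.conj ((e ⊓ f).1 * s) = (e ⊓ f).conj s := by rw [Idem.conj_mul, h2]
        have k2 : g.conj ((e ⊓ f).1 * s * ((e ⊓ f).conj s).1) = e.conj s ⊓ f.conj s := by
          rw [Idem.conj_mul, k1, h1]
        have k3 : g.conj (s * (e.conj s ⊓ f.conj s).1) = e.conj s ⊓ f.conj s := by
          rw [Idem.conj_mul, h3]
        rw [shift_shift _ _ _ _ k1, shift_shift _ _ _ _ k2, shift_shift _ _ _ _ k3]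
        apply key
        rw [← hE]
        generalize e ⊓ f = d
        have hd := mul_idem_eq d.2 s
        rw [Idem.conj_val, mul_assoc d.1, ← hd, ← mul_assoc d.1, d.2.eq]
      have h1 : ((e ⊓ f).conj s).conj ((e ⊓ f).conj s).1 = e.conj s ⊓ f.conj s := by
        rw [Idem.conj_of_le le_rfl, hE]
      refine Eq.trans ?_ (congrArg₂ (· + ·)
        (P e inf_le_left a h1 (Idem.conj_of_le inf_le_left) (Idem.conj_of_le inf_le_left))
        (P f inf_le_right b h1 (Idem.conj_of_le inf_le_right) (Idem.conj_of_le inf_le_right)))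
      exact (congrArg (shift ((e ⊓ f).conj s).1 _) (map_add (shift s rfl) _ _)).trans
        (map_add _ _ _)
    act_mul := by
      rintro ⟨e, a⟩ s t
      have hE := Idem.conj_mul e s t
      have hc : (e.conj (s * t)).conj (e.conj (s * t)).1 = (e.conj s).conj t := by
        rw [Idem.conj_of_le le_rfl, hE]
      have k : e.conj (s * t * (e.conj (s * t)).1) = (e.conj s).conj t := by
        rw [Idem.conj_mul, hc]
      refine sig hE hc _ _ ?_
      dsimp only
      rw [shift_shift _ _ _ _ k, shift_shift _ _ _ _ hE]
      apply key
      have hd := mul_idem_eq e.2 (s * t)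
      rw [Idem.conj_val, ← hd, ← mul_assoc e.1, e.2.eq]
    act_idem := by
      rintro ⟨e, a⟩ f
      have hE := Idem.conj_idem e f
      have hc : (e.conj f.1).conj (e.conj f.1).1 = e ⊓ f := by
        rw [Idem.conj_of_le le_rfl, hE]
      have k : e.conj (f.1 * (e.conj f.1).1) = e ⊓ f := by
        rw [Idem.conj_mul, hc]
      refine sig hE hc _ _ ?_
      dsimp only
      rw [map_zero, add_zero, shift_shift _ _ _ _ k]
      apply key
      have hd := mul_idem_eq e.2 f.1
      rw [Idem.inf_val, Idem.conj_val, ← hd]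
    zero_act := by
      intro e s
      dsimp only
      rw [map_zero] }

end OfShift

/-! ### The kernel of an idempotent separating homomorphism and its abelianisation -/

section Kernel

variable {T : Type u} {S : Type v} [InverseMonoid T] [InverseMonoid S]

/-- Surjective idempotent separating homomorphisms. -/
structure IsIdemSep (ψ : T →* S) : Prop where
  surj : Function.Surjective ψ
  sep : ∀ e f : T, IsIdempotentElem e → IsIdempotentElem f → ψ e = ψ f → e = f

variable {ψ : T →* S}

theorem IsIdemSep.exists_tilde (h : IsIdemSep ψ) (e : Idem S) :
    ∃ t : T, IsIdempotentElem t ∧ ψ t = e.1 := by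
  obtain ⟨t, ht⟩ := h.surj e.1
  exact ⟨t⁻¹ * t, idem_inv_mul t, by rw [map_mul, map_inv_eq, ht, idem_inv e.2, e.2.eq]⟩

/-- The unique idempotent of `T` that is mapped by `ψ` to the idempotent `e` of `S`. -/
def IsIdemSep.tilde (h : IsIdemSep ψ) (e : Idem S) : T := (h.exists_tilde e).choose

theorem IsIdemSep.tilde_idem (h : IsIdemSep ψ) (e : Idem S) : IsIdempotentElem (h.tilde e) :=
  (h.exists_tilde e).choose_spec.1

theorem IsIdemSep.map_tilde (h : IsIdemSep ψ) (e : Idem S) : ψ (h.tilde e) = e.1 :=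
  (h.exists_tilde e).choose_spec.2

theorem IsIdemSep.eq_tilde (h : IsIdemSep ψ) {e : Idem S} {t : T} (ht : IsIdempotentElem t)
    (hte : ψ t = e.1) : t = h.tilde e :=
  h.sep _ _ ht (h.tilde_idem e) (hte.trans (h.map_tilde e).symm)

theorem IsIdemSep.mul_inv_eq (h : IsIdemSep ψ) {e : Idem S} {t : T} (ht : ψ t = e.1) :
    t * t⁻¹ = h.tilde e :=
  h.eq_tilde (idem_mul_inv t) (by rw [map_mul, map_inv_eq, ht, idem_inv e.2, e.2.eq])

theorem IsIdemSep.inv_mul_eq (h : IsIdemSep ψ) {e : Idem S} {t : T} (ht : ψ t = e.1) :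
    t⁻¹ * t = h.tilde e :=
  h.eq_tilde (idem_inv_mul t) (by rw [map_mul, map_inv_eq, ht, idem_inv e.2, e.2.eq])

theorem IsIdemSep.tilde_mul (h : IsIdemSep ψ) {e : Idem S} {t : T} (ht : ψ t = e.1) :
    h.tilde e * t = t := by
  rw [← h.mul_inv_eq ht, mul_assoc, mim]

theorem IsIdemSep.mul_tilde (h : IsIdemSep ψ) {e : Idem S} {t : T} (ht : ψ t = e.1) :
    t * h.tilde e = t := by
  rw [← h.inv_mul_eq ht, mim]

/-- Idempotents commute with the elements of the kernel of `ψ`. -/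
theorem IsIdemSep.central (h : IsIdemSep ψ) {e : Idem S} {k f : T} (hk : ψ k = e.1)
    (hf : IsIdempotentElem f) : k * f = f * k := by
  have hψf : IsIdempotentElem (ψ f) := by rw [IsIdempotentElem, ← map_mul, hf.eq]
  have h1 : k⁻¹⁻¹ * f * k⁻¹ = k * k⁻¹ * f := by
    apply h.sep _ _ (idem_conj hf _) (idem_mul (idem_mul_inv k) hf)
    simp only [map_mul, map_inv_eq, hk, inv_inv_eq, idem_inv e.2]
    rw [idem_comm e.2 hψf, mul_assoc, e.2.eq, idem_comm e.2 hψf]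
  rw [inv_inv_eq] at h1
  calc k * f = k * (k⁻¹ * k * f) := by rw [← mul_assoc, mim]
    _ = k * (f * (k⁻¹ * k)) := by rw [idem_comm (idem_inv_mul k) hf]
    _ = (k * f * k⁻¹) * k := by simp only [mul_assoc]
    _ = (f * (k * k⁻¹)) * k := by rw [h1, idem_comm (idem_mul_inv k) hf]
    _ = f * k := by rw [mul_assoc, mul_assoc, mim]

/-- The group `K_e`: the elements of `T` that are mapped by `ψ` to the idempotent `e` of `S`.
The kernel of `ψ` is the disjoint union of these groups. -/
@[ext]
structure KerGroup (h : IsIdemSep ψ) (e : Idem S) : Type u where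
  val : T
  map_val : ψ val = e.1

variable (h : IsIdemSep ψ)

/-- The product and the inverse of `K_e` are those of `T`; its identity is `h.tilde e`. -/
instance (e : Idem S) : Group (KerGroup h e) where
  mul a b := ⟨a.1 * b.1, by rw [map_mul, a.2, b.2, e.2.eq]⟩
  one := ⟨h.tilde e, h.map_tilde e⟩
  inv a := ⟨a.1⁻¹, by rw [map_inv_eq, a.2, idem_inv e.2]⟩
  mul_assoc a b c := KerGroup.ext (mul_assoc _ _ _)
  one_mul a := KerGroup.ext (h.tilde_mul a.2)
  mul_one a := KerGroup.ext (h.mul_tilde a.2)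
  inv_mul_cancel a := KerGroup.ext (h.inv_mul_eq a.2)

theorem KerGroup.mul_val {e : Idem S} (a b : KerGroup h e) : (a * b).1 = a.1 * b.1 := rfl
theorem KerGroup.one_val (e : Idem S) : (1 : KerGroup h e).1 = h.tilde e := rfl
theorem KerGroup.inv_val {e : Idem S} (a : KerGroup h e) : (a⁻¹).1 = (a.1)⁻¹ := rfl

/-- Conjugation `k ↦ t⁻¹ k t`, from `K_e` to `K_{s⁻¹es}`, where `s = ψ t`. -/
def conjHom {e e' : Idem S} (t : T) (he : e.conj (ψ t) = e') : KerGroup h e →* KerGroup h e' where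
  toFun k := ⟨t⁻¹ * k.1 * t, by
    rw [map_mul, map_mul, map_inv_eq, k.2, ← he, Idem.conj_val]⟩
  map_one' := KerGroup.ext (h.eq_tilde (idem_conj (h.tilde_idem e) t) (by
    change ψ (t⁻¹ * h.tilde e * t) = e'.1
    rw [map_mul, map_mul, map_inv_eq, h.map_tilde, ← he, Idem.conj_val]))
  map_mul' k l := KerGroup.ext (by
    have hc := congrArg (fun z => t⁻¹ * (z * (l.1 * t))) (h.central k.2 (idem_mul_inv t))
    change t⁻¹ * (k.1 * l.1) * t = (t⁻¹ * k.1 * t) * (t⁻¹ * l.1 * t)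
    simp only [mul_assoc, imi_assoc] at hc ⊢
    exact hc.symm)

theorem conjHom_val {e e' : Idem S} (t : T) (he : e.conj (ψ t) = e') (k : KerGroup h e) :
    (conjHom h t he k).1 = t⁻¹ * k.1 * t := rfl

/-- The abelianisation of `K_e`, written additively. -/
abbrev KerAb (e : Idem S) : Type u := Additive (Abelianization (KerGroup h e))

/-- The canonical map from `K_e` to its abelianisation. -/
def KerAb.of {e : Idem S} (k : KerGroup h e) : KerAb h e := Additive.ofMul (Abelianization.of k)

theorem conjHom_indep {e e' : Idem S} (t u : T) (htu : ψ t = ψ u) (ht : e.conj (ψ t) = e')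
    (hu : e.conj (ψ u) = e') (k : KerGroup h e) :
    KerAb.of h (conjHom h t ht k) = KerAb.of h (conjHom h u hu k) := by
  have hg : ψ (t⁻¹ * h.tilde e * u) = e'.1 := by
    rw [map_mul, map_mul, map_inv_eq, h.map_tilde, htu, ← hu, Idem.conj_val]
  have htt : t * t⁻¹ = u * u⁻¹ := h.sep _ _ (idem_mul_inv t) (idem_mul_inv u) (by
    rw [map_mul, map_mul, map_inv_eq, map_inv_eq, htu])
  let g : KerGroup h e' := ⟨t⁻¹ * h.tilde e * u, hg⟩
  have hcomm : conjHom h t ht k * g = g * conjHom h u hu k := by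
    apply KerGroup.ext
    rw [KerGroup.mul_val, KerGroup.mul_val, conjHom_val, conjHom_val]
    change t⁻¹ * k.1 * t * (t⁻¹ * h.tilde e * u) = t⁻¹ * h.tilde e * u * (u⁻¹ * k.1 * u)
    calc t⁻¹ * k.1 * t * (t⁻¹ * h.tilde e * u)
        = t⁻¹ * (k.1 * (t * t⁻¹)) * h.tilde e * u := by simp only [mul_assoc]
      _ = t⁻¹ * (t * t⁻¹) * (k.1 * h.tilde e) * u := by
          rw [h.central k.2 (idem_mul_inv t)]; simp only [mul_assoc]
      _ = t⁻¹ * k.1 * u := by rw [imi, h.mul_tilde k.2]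
      _ = t⁻¹ * h.tilde e * k.1 * (u * (u⁻¹ * u)) := by
          rw [mul_assoc t⁻¹ (h.tilde e), h.tilde_mul k.2, mim]
      _ = t⁻¹ * h.tilde e * (k.1 * (u * u⁻¹)) * u := by simp only [mul_assoc]
      _ = t⁻¹ * h.tilde e * u * (u⁻¹ * k.1 * u) := by
          rw [h.central k.2 (idem_mul_inv u)]; simp only [mul_assoc]
  have := congrArg (Abelianization.of) hcomm
  rw [map_mul, map_mul, mul_comm] at this
  exact congrArg Additive.ofMul (mul_left_cancel this)

/-- The map `K_e^{ab} → K_{s⁻¹es}^{ab}` induced by conjugation by an element `t` with `ψ t = s`. -/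
def kerShift {e e' : Idem S} (s : S) (he : e.conj s = e') : KerAb h e →+ KerAb h e' :=
  MonoidHom.toAdditive (Abelianization.map
    (conjHom h (h.surj s).choose (by rw [(h.surj s).choose_spec, he])))

theorem kerShift_of {e e' : Idem S} (s : S) (he : e.conj s = e') (t : T) (ht : ψ t = s)
    (k : KerGroup h e) :
    kerShift h s he (KerAb.of h k) = KerAb.of h (conjHom h t (by rw [ht, he]) k) := by
  refine Eq.trans ?_ (conjHom_indep h (h.surj s).choose t
    ((h.surj s).choose_spec.trans ht.symm) (by rw [(h.surj s).choose_spec, he]) _ k)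
  rfl

theorem kerAb_induction {e : Idem S} {p : KerAb h e → Prop} (hp : ∀ k, p (KerAb.of h k))
    (a : KerAb h e) : p a := by
  obtain ⟨k, hk⟩ := QuotientGroup.mk_surjective (Additive.toMul a)
  have h1 : KerAb.of h k = a := congrArg Additive.ofMul hk
  exact h1 ▸ hp k

/-- The abelianised kernel `⊔_e K_e^{ab}` of a surjective idempotent separating homomorphism
`ψ : T → S`, an `S`-module under the conjugation action `k ⊲ s = t⁻¹ k t`, where `ψ t = s`. -/
def abKernel : LauschModule.{v, u} S :=
  LauschModule.ofShift (A := KerAb h) (kerShift h)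
    (by
      intro e he a
      induction a using kerAb_induction with
      | hp k =>
        rw [kerShift_of h e.1 he (h.tilde e) (h.map_tilde e)]
        congr 1
        apply KerGroup.ext
        rw [conjHom_val, idem_inv (h.tilde_idem e), h.tilde_mul k.2, h.mul_tilde k.2])
    (by
      intro e e' e'' s t hs ht hst a
      induction a using kerAb_induction with
      | hp k =>
        obtain ⟨x, hx⟩ := h.surj s
        obtain ⟨y, hy⟩ := h.surj t
        rw [kerShift_of h s hs x hx, kerShift_of h t ht y hy,
          kerShift_of h (s * t) hst (x * y) (by rw [map_mul, hx, hy])]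
        congr 1
        apply KerGroup.ext
        simp only [conjHom_val, mul_inv_rev_eq, mul_assoc])

/-- The action on the abelianised kernel is conjugation by any preimage. -/
theorem abKernel_act (e : Idem S) (k : KerGroup h e) (t : T) :
    (abKernel h).act ⟨e, KerAb.of h k⟩ (ψ t) =
      ⟨e.conj (ψ t), KerAb.of h (conjHom h t rfl k)⟩ :=
  congrArg (Sigma.mk (e.conj (ψ t))) (kerShift_of h (ψ t) rfl t rfl k)

/-- The structure maps of the abelianised kernel are induced by those of the Clifford semigroup
`⊔_e K_e`, that is, by multiplication by idempotents. -/
theorem abKernel_res {e f : Idem S} (hf : f ≤ e) (k : KerGroup h e) :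
    (abKernel h).res hf (KerAb.of h k) = KerAb.of h (⟨k.1 * h.tilde f, by
      rw [map_mul, k.2, h.map_tilde, idem_comm e.2 f.2]; exact hf⟩ : KerGroup h f) := by
  refine (kerShift_of h f.1 (Idem.conj_of_le hf) (h.tilde f) (h.map_tilde f) k).trans ?_
  congr 1
  apply KerGroup.ext
  rw [conjHom_val, idem_inv (h.tilde_idem f), ← h.central k.2 (h.tilde_idem f), mul_assoc,
    (h.tilde_idem f).eq]

end Kernel

/-! ### Free inverse monoids, presentations, and the factorisation of a presentation map -/

/-- Words in the alphabet `X ⊔ X⁻¹`: `Sum.inl x` is the letter `x` and `Sum.inr x` is `x⁻¹`. -/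
abbrev Word (X : Type u) : Type u := FreeMonoid (X ⊕ X)

/-- The formal inverse of a word: reverse it and invert each letter. -/
def winv {X : Type u} (w : Word X) : Word X := FreeMonoid.map Sum.swap w.reverse

theorem winv_mul {X : Type u} (v w : Word X) : winv (v * w) = winv w * winv v := by
  rw [winv, FreeMonoid.reverse_mul, map_mul]; rfl

theorem winv_winv {X : Type u} (w : Word X) : winv (winv w) = w := by
  have h : ∀ l : List (X ⊕ X),
      List.map Sum.swap (List.reverse (List.map Sum.swap (List.reverse l))) = l := by
    intro l
    rw [← List.map_reverse, List.reverse_reverse, List.map_map, Sum.swap_swap_eq, List.map_id]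
  exact h w

/-- The relations that generate the Wagner congruence. -/
inductive WagnerRel (X : Type u) : Word X → Word X → Prop
  | reg (w : Word X) : WagnerRel X (w * winv w * w) w
  | comm (v w : Word X) : WagnerRel X (v * winv v * (w * winv w)) (w * winv w * (v * winv v))

/-- The Wagner congruence on the free monoid on `X ⊔ X⁻¹`. -/
def wagner (X : Type u) : Con (Word X) := conGen (WagnerRel X)

theorem wagner_winv {X : Type u} {v w : Word X} (h : wagner X v w) :
    wagner X (winv v) (winv w) := by
  induction h with
  | of x y h =>
    apply ConGen.Rel.of
    cases h with
    | reg =>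
      have := WagnerRel.reg (winv y)
      rw [winv_winv] at this
      simpa only [winv_mul, winv_winv, mul_assoc] using this
    | comm v w =>
      have := WagnerRel.comm w v
      simpa only [winv_mul, winv_winv, mul_assoc] using this
  | refl x => exact (wagner X).refl _
  | symm _ ih => exact (wagner X).symm ih
  | trans _ _ ih₁ ih₂ => exact (wagner X).trans ih₁ ih₂
  | mul _ _ ih₁ ih₂ =>
    rw [winv_mul, winv_mul]
    exact (wagner X).mul ih₂ ih₁

/-- The free inverse monoid on `X`. -/
def FIM (X : Type u) : Type u := (wagner X).Quotient

instance (X : Type u) : Monoid (FIM X) := inferInstanceAs (Monoid (wagner X).Quotient)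

/-- The natural map from words to the free inverse monoid. -/
def rho (X : Type u) : Word X →* FIM X := (wagner X).mk'

theorem rho_surjective (X : Type u) : Function.Surjective (rho X) := Con.mk'_surjective

theorem rho_eq {X : Type u} {v w : Word X} : rho X v = rho X w ↔ wagner X v w :=
  (wagner X).eq

instance (X : Type u) : Inv (FIM X) :=
  ⟨fun a => Con.liftOn a (fun w => rho X (winv w)) fun _ _ h => rho_eq.2 (wagner_winv h)⟩

theorem rho_winv {X : Type u} (w : Word X) : rho X (winv w) = (rho X w)⁻¹ := rfl

instance (X : Type u) : InverseMonoid (FIM X) :=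
  InverseMonoid.ofStar (FIM X)
    (fun a => by
      obtain ⟨w, rfl⟩ := rho_surjective X a
      rw [← rho_winv, ← map_mul, ← map_mul]
      exact rho_eq.2 (ConGen.Rel.of _ _ (WagnerRel.reg w)))
    (fun a => by
      obtain ⟨w, rfl⟩ := rho_surjective X a
      rw [← rho_winv, ← rho_winv, winv_winv])
    (fun a b => by
      obtain ⟨v, rfl⟩ := rho_surjective X a
      obtain ⟨w, rfl⟩ := rho_surjective X b
      rw [← map_mul, ← rho_winv, winv_mul, map_mul, rho_winv, rho_winv])
    (fun a b => by
      obtain ⟨v, rfl⟩ := rho_surjective X a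
      obtain ⟨w, rfl⟩ := rho_surjective X b
      simp only [← rho_winv, ← map_mul]
      exact rho_eq.2 (ConGen.Rel.of _ _ (WagnerRel.comm v w)))

/-- The generator of the free inverse monoid given by `x ∈ X`. -/
def FIM.of {X : Type u} (x : X) : FIM X := rho X (FreeMonoid.of (Sum.inl x))

section Presentation

variable {X : Type u} {M : Type v} [InverseMonoid M]

/-- `θ : FIM(X) → M` is the presentation map of the inverse monoid presentation `[X : R]` of `M`,
where `R` is a set of pairs of words: it is surjective, and the congruence that it induces is the
one generated by the relations. -/
structure IsPresentation (R : Set (Word X × Word X)) (θ : FIM X →* M) : Prop where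
  surj : Function.Surjective θ
  ker_eq : Con.ker θ = conGen fun a b => ∃ p ∈ R, a = rho X p.1 ∧ b = rho X p.2

variable (θ : FIM X →* M)

/-- The relation `θ_min` on `FIM(X)`: there is an idempotent `e` with `a e = b e` such that
`a⁻¹ a`, `e` and `b⁻¹ b` have the same image under `θ`. -/
def MinRel (a b : FIM X) : Prop :=
  ∃ e : FIM X, IsIdempotentElem e ∧ a * e = b * e ∧ θ (a⁻¹ * a) = θ e ∧ θ e = θ (b⁻¹ * b)

theorem minRel_iff {a b : FIM X} :
    MinRel θ a b ↔ ∃ c, NatLE c a ∧ NatLE c b ∧ θ a = θ c ∧ θ c = θ b := by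
  constructor
  · rintro ⟨e, he, hab, h1, h2⟩
    refine ⟨a * e, ⟨e, he, rfl⟩, ⟨e, he, hab⟩, ?_, ?_⟩
    · rw [map_mul, ← h1, ← map_mul, mim]
    · rw [hab, map_mul, h2, ← map_mul, mim]
  · rintro ⟨c, h1, h2, h3, h4⟩
    refine ⟨c⁻¹ * c, idem_inv_mul c, ?_, ?_, ?_⟩
    · rw [natLE_iff.1 h1, natLE_iff.1 h2]
    · rw [map_mul, map_mul, map_inv_eq, map_inv_eq, h3]
    · rw [map_mul, map_mul, map_inv_eq, map_inv_eq, h4]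

theorem minRel_inv {a b : FIM X} (h : MinRel θ a b) : MinRel θ a⁻¹ b⁻¹ := by
  rw [minRel_iff] at h ⊢
  obtain ⟨c, h1, h2, h3, h4⟩ := h
  exact ⟨c⁻¹, natLE_inv h1, natLE_inv h2, by rw [map_inv_eq, map_inv_eq, h3],
    by rw [map_inv_eq, map_inv_eq, h4]⟩

/-- The smallest congruence on `FIM(X)` that has the same trace as the congruence induced
by `θ`. -/
def thetaMin : Con (FIM X) where
  r := MinRel θ
  iseqv :=
    { refl := fun a => (minRel_iff θ).2 ⟨a, natLE_refl a, natLE_refl a, rfl, rfl⟩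
      symm := fun h => by
        rw [minRel_iff] at h ⊢
        obtain ⟨c, h1, h2, h3, h4⟩ := h
        exact ⟨c, h2, h1, h4.symm, h3.symm⟩
      trans := fun {a b c} h h' => by
        rw [minRel_iff] at h h' ⊢
        obtain ⟨x, h1, h2, h3, h4⟩ := h
        obtain ⟨y, k1, k2, k3, k4⟩ := h'
        obtain ⟨e, he, rfl⟩ := h2
        obtain ⟨f, hf, rfl⟩ := k1
        refine ⟨b * e * f, natLE_trans ⟨f, hf, rfl⟩ h1, natLE_trans ⟨e, he, ?_⟩ k2, ?_, ?_⟩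
        · rw [mul_assoc, mul_assoc, idem_comm he hf]
        · rw [map_mul, h4, h3, h4, ← map_mul, ← k3]
        · rw [map_mul, h4, ← map_mul, k4] }
  mul' := fun {a b c d} h h' => by
    change MinRel θ _ _ at h h'
    rw [minRel_iff] at h h' ⊢
    obtain ⟨x, h1, h2, h3, h4⟩ := h
    obtain ⟨y, k1, k2, k3, k4⟩ := h'
    exact ⟨x * y, natLE_mul h1 k1, natLE_mul h2 k2, by rw [map_mul, map_mul, h3, k3],
      by rw [map_mul, map_mul, h4, k4]⟩

/-- The inverse monoid `T(M, X) = FIM(X) / θ_min`. -/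
def TMon : Type u := (thetaMin θ).Quotient

instance : Monoid (TMon θ) := inferInstanceAs (Monoid (thetaMin θ).Quotient)

/-- The canonical map `τ : FIM(X) → T(M, X)`. -/
def tau : FIM X →* TMon θ := (thetaMin θ).mk'

theorem tau_surjective : Function.Surjective (tau θ) := Con.mk'_surjective

theorem tau_eq {a b : FIM X} : tau θ a = tau θ b ↔ MinRel θ a b := (thetaMin θ).eq

instance : Inv (TMon θ) :=
  ⟨fun a => Con.liftOn a (fun w => tau θ w⁻¹) fun _ _ h => (tau_eq θ).2 (minRel_inv θ h)⟩

theorem tau_inv (a : FIM X) : tau θ a⁻¹ = (tau θ a)⁻¹ := rfl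

instance : InverseMonoid (TMon θ) :=
  InverseMonoid.ofStar (TMon θ)
    (fun a => by
      obtain ⟨w, rfl⟩ := tau_surjective θ a
      rw [← tau_inv, ← map_mul, ← map_mul, mul_assoc, mim])
    (fun a => by
      obtain ⟨w, rfl⟩ := tau_surjective θ a
      rw [← tau_inv, ← tau_inv, inv_inv_eq])
    (fun a b => by
      obtain ⟨v, rfl⟩ := tau_surjective θ a
      obtain ⟨w, rfl⟩ := tau_surjective θ b
      rw [← map_mul, ← tau_inv, mul_inv_rev_eq, map_mul, tau_inv, tau_inv])
    (fun a b => by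
      obtain ⟨v, rfl⟩ := tau_surjective θ a
      obtain ⟨w, rfl⟩ := tau_surjective θ b
      simp only [← tau_inv, ← map_mul]
      rw [idem_comm (idem_mul_inv v) (idem_mul_inv w)])

/-- The canonical map `ψ : T(M, X) → M`, with `ψ (τ a) = θ a`. -/
def psi : TMon θ →* M := (thetaMin θ).lift θ (by
  intro a b h
  change MinRel θ a b at h
  rw [minRel_iff] at h
  obtain ⟨c, -, -, h3, h4⟩ := h
  exact h3.trans h4)

theorem psi_tau (a : FIM X) : psi θ (tau θ a) = θ a := rfl

variable {θ}

theorem psi_isIdemSep (hθ : Function.Surjective θ) : IsIdemSep (psi θ) where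
  surj m := by
    obtain ⟨a, rfl⟩ := hθ m
    exact ⟨tau θ a, rfl⟩
  sep e f he hf hef := by
    obtain ⟨a, ha⟩ := tau_surjective θ e
    obtain ⟨b, hb⟩ := tau_surjective θ f
    have ha' : tau θ (a⁻¹ * a) = e := by rw [map_mul, tau_inv, ha, idem_inv he, he.eq]
    have hb' : tau θ (b⁻¹ * b) = f := by rw [map_mul, tau_inv, hb, idem_inv hf, hf.eq]
    have hab : θ (a⁻¹ * a) = θ (b⁻¹ * b) := by rw [← psi_tau θ, ← psi_tau θ, ha', hb', hef]
    rw [← ha', ← hb', tau_eq, minRel_iff]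
    refine ⟨a⁻¹ * a * (b⁻¹ * b), ⟨_, idem_inv_mul b, rfl⟩, ⟨_, idem_inv_mul a, ?_⟩, ?_, ?_⟩
    · exact idem_comm (idem_inv_mul a) (idem_inv_mul b)
    · rw [map_mul θ (a⁻¹ * a), ← hab, ← map_mul, (idem_inv_mul a).eq]
    · rw [map_mul θ (a⁻¹ * a), hab, ← map_mul, (idem_inv_mul b).eq]

/-- The relation module of an inverse monoid presentation with presentation map `θ`: the
abelianised kernel of `ψ : T(M, X) → M`. -/
def relationModule (hθ : Function.Surjective θ) : LauschModule.{v, u} M :=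
  abKernel (psi_isIdemSep hθ)

/-! ### The left Schützenberger graph and its homology -/

variable (θ)

/-- There is an `x`-labelled edge with initial vertex `s` if and only if
`(x⁻¹ x) θ ≥ s s⁻¹`. -/
def IsEdge (x : X) (s : M) : Prop := NatLE (s * s⁻¹) (θ ((FIM.of x)⁻¹ * FIM.of x))

variable {θ}

theorem IsEdge.eq {x : X} {s : M} (h : IsEdge θ x s) :
    (θ (FIM.of x))⁻¹ * (θ (FIM.of x) * s) = s := by
  obtain ⟨f, hf, h⟩ := h
  rw [map_mul, map_inv_eq] at h
  have h1 : s = (θ (FIM.of x))⁻¹ * θ (FIM.of x) * f * s := by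
    rw [← h, mul_assoc, mim]
  rw [h1]
  simp only [mul_assoc, imi_assoc]

theorem isEdge_of_eq {x : X} {s : M} (h : (θ (FIM.of x))⁻¹ * (θ (FIM.of x) * s) = s) :
    IsEdge θ x s := by
  refine ⟨s * s⁻¹, idem_mul_inv s, ?_⟩
  rw [map_mul, map_inv_eq]
  have := congrArg (· * s⁻¹) h
  simp only [mul_assoc] at this ⊢
  exact this.symm

theorem IsEdge.mul {x : X} {s : M} (h : IsEdge θ x s) (t : M) : IsEdge θ x (s * t) := by
  apply isEdge_of_eq
  have := congrArg (· * t) h.eq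
  simp only [mul_assoc] at this ⊢
  exact this

/-- The two end points of an edge are in the same `L`-class. -/
theorem IsEdge.inv_mul {x : X} {s : M} (h : IsEdge θ x s) :
    (θ (FIM.of x) * s)⁻¹ * (θ (FIM.of x) * s) = s⁻¹ * s := by
  rw [mul_inv_rev_eq, mul_assoc, h.eq]

/-- The `L`-class `L_e` of the idempotent `e`, consisting of all `s` with `s⁻¹ s = e`: the vertex
set of the component of the left Schützenberger graph that contains `e`. -/
@[ext]
structure Vert (e : Idem M) : Type v where
  val : M
  inv_mul : val⁻¹ * val = e.1

variable (θ) in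
/-- The edges of the component of the left Schützenberger graph that contains `e`: the pair `(x, s)`
is an edge from `s` to `(x θ) s`. -/
@[ext]
structure Edge (e : Idem M) : Type (max u v) where
  x : X
  s : M
  isEdge : IsEdge θ x s
  inv_mul : s⁻¹ * s = e.1

/-- The initial vertex of an edge. -/
def Edge.src {e : Idem M} (p : Edge θ e) : Vert e := ⟨p.s, p.inv_mul⟩

/-- The terminal vertex of an edge. -/
def Edge.tgt {e : Idem M} (p : Edge θ e) : Vert e :=
  ⟨θ (FIM.of p.x) * p.s, p.isEdge.inv_mul.trans p.inv_mul⟩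

theorem shift_inv_mul {e e' : Idem M} (t : M) (h : e.conj t = e') {s : M} (hs : s⁻¹ * s = e.1) :
    (s * t)⁻¹ * (s * t) = e'.1 := by
  rw [← h, Idem.conj_val, mul_inv_rev_eq, ← hs]
  simp only [mul_assoc]

/-- The action `s ⊲ t = s t` on vertices. -/
def Vert.shift {e e' : Idem M} (t : M) (h : e.conj t = e') (s : Vert e) : Vert e' :=
  ⟨s.1 * t, shift_inv_mul t h s.2⟩

/-- The action `(x, s) ⊲ t = (x, s t)` on edges. -/
def Edge.shift {e e' : Idem M} (t : M) (h : e.conj t = e') (p : Edge θ e) : Edge θ e' :=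
  ⟨p.x, p.s * t, p.isEdge.mul t, shift_inv_mul t h p.inv_mul⟩

/-- The cellular chain group `C_0` of a component. -/
abbrev C0 (e : Idem M) : Type v := FreeAbelianGroup (Vert e)

variable (θ) in
/-- The cellular chain group `C_1` of a component. -/
abbrev C1 (e : Idem M) : Type (max u v) := FreeAbelianGroup (Edge θ e)

variable (θ) in
/-- The boundary map `(x, s) ↦ (x θ) s - s`. -/
def bdry (e : Idem M) : C1 θ e →+ C0 e :=
  FreeAbelianGroup.lift fun p => FreeAbelianGroup.of p.tgt - FreeAbelianGroup.of p.src

theorem bdry_of {e : Idem M} (p : Edge θ e) : bdry θ e (FreeAbelianGroup.of p) =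
    FreeAbelianGroup.of p.tgt - FreeAbelianGroup.of p.src :=
  FreeAbelianGroup.lift_apply_of _ _

variable (θ) in
/-- The first homology group of the component that contains `e`. -/
abbrev H1 (e : Idem M) : Type (max u v) := (bdry θ e).ker

theorem bdry_shift {e e' : Idem M} (t : M) (h : e.conj t = e') (c : C1 θ e) :
    bdry θ e' (FreeAbelianGroup.map (Edge.shift t h) c) =
      FreeAbelianGroup.map (Vert.shift t h) (bdry θ e c) := by
  have : (bdry θ e').comp (FreeAbelianGroup.map (Edge.shift t h)) =
      (FreeAbelianGroup.map (Vert.shift t h)).comp (bdry θ e) := by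
    apply FreeAbelianGroup.lift_ext
    intro p
    rw [AddMonoidHom.comp_apply, AddMonoidHom.comp_apply, FreeAbelianGroup.map_of_apply, bdry_of,
      bdry_of, map_sub, FreeAbelianGroup.map_of_apply, FreeAbelianGroup.map_of_apply]
    congr 2
    exact Vert.ext (mul_assoc _ _ _).symm
  exact DFunLike.congr_fun this c

variable (θ) in
/-- The map on homology induced by right translation by `t`. -/
def homShift {e e' : Idem M} (t : M) (h : e.conj t = e') : H1 θ e →+ H1 θ e' :=
  ((FreeAbelianGroup.map (Edge.shift t h)).comp (bdry θ e).ker.subtype).codRestrict _ (by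
    rintro ⟨c, hc⟩
    rw [AddMonoidHom.mem_ker] at hc ⊢
    rw [AddMonoidHom.comp_apply, AddSubgroup.coe_subtype, bdry_shift, hc, map_zero])

theorem homShift_val {e e' : Idem M} (t : M) (h : e.conj t = e') (z : H1 θ e) :
    (homShift θ t h z).1 = FreeAbelianGroup.map (Edge.shift t h) z.1 := rfl

variable (θ) in
/-- The `M`-module formed by the first homology groups of the components of the left Schützenberger
graph of `(M, X)`, with the action that is induced by `(x, s) ⊲ t = (x, s t)`. -/
def homologyModule : LauschModule.{v, max u v} M :=
  LauschModule.ofShift (A := fun e => H1 θ e) (homShift θ)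
    (by
      intro e h z
      apply Subtype.ext
      rw [homShift_val]
      have : Edge.shift (θ := θ) e.1 h = id := by
        funext p
        refine Edge.ext rfl ?_
        change p.s * e.1 = p.s
        rw [← p.inv_mul, mim]
      rw [this, FreeAbelianGroup.map_id]
      rfl)
    (by
      intro e e' e'' s t h h' h'' z
      apply Subtype.ext
      rw [homShift_val, homShift_val, homShift_val, ← AddMonoidHom.comp_apply,
        ← FreeAbelianGroup.map_comp]
      congr 2
      funext p
      exact Edge.ext rfl (mul_assoc _ _ _))

/-! ### The fundamental groups -/

variable (θ) in
/-- The vertices of the left Schützenberger graph of `(M, X)`. -/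
def Sch (_θ : FIM X →* M) : Type v := M

/-- The left Schützenberger graph as a quiver: the edges from `s` to `t` are the `x ∈ X` such that
there is an `x`-labelled edge with initial vertex `s`, and `(x θ) s = t`. -/
instance : Quiver.{u} (Sch θ) where
  Hom s t := {x : X // IsEdge θ x (show M from s) ∧ θ (FIM.of x) * (show M from s) = t}

variable (θ) in
/-- Edge paths in the left Schützenberger graph, in which edges may be traversed in both
directions. -/
abbrev SchPath (s t : M) : Type (max u v) :=
  @Quiver.Path (Quiver.Symmetrify (Sch θ)) _ s t

variable (θ) in
/-- The fundamental group `π_e` at `e` of the left Schützenberger graph: the vertex group at `e` of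
its fundamental groupoid, which consists of the classes of edge paths modulo insertion and deletion
of subpaths that traverse an edge and return along it. -/
def FundGroup (e : Idem M) : Type (max u v) :=
  (⟨(e.1 : M)⟩ : Quiver.FreeGroupoid (Sch θ)) ⟶ ⟨(e.1 : M)⟩

instance (e : Idem M) : Group (FundGroup θ e) :=
  CategoryTheory.Groupoid.vertexGroup (C := Quiver.FreeGroupoid (Sch θ)) ⟨(e.1 : M)⟩

/-- The homotopy class of a closed edge path. -/
def SchPath.cls {e : Idem M} (p : SchPath θ e.1 e.1) : FundGroup θ e :=
  (CategoryTheory.Quotient.functor (Quiver.FreeGroupoid.redStep (V := Sch θ))).map p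

/-- The word that labels an edge path: an edge with label `x` contributes the letter `x` if it is
traversed from its initial to its terminal vertex, and the letter `x⁻¹` otherwise. -/
def SchPath.word {s : M} : ∀ {t : M}, SchPath θ s t → Word X
  | _, .nil => 1
  | _, .cons p (.inl x) => SchPath.word p * FreeMonoid.of (Sum.inl x.1)
  | _, .cons p (.inr x) => SchPath.word p * FreeMonoid.of (Sum.inr x.1)

/-- An edge path stays in an `L`-class. -/
theorem SchPath.inv_mul {s : M} : ∀ {t : M}, SchPath θ s t → t⁻¹ * t = s⁻¹ * s
  | _, .nil => rfl
  | _, .cons p (.inl x) => by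
    have h := x.2.1.inv_mul
    rw [x.2.2] at h
    exact h.trans (SchPath.inv_mul p)
  | _, .cons p (.inr x) => by
    have h := x.2.1.inv_mul
    rw [x.2.2] at h
    exact h.symm.trans (SchPath.inv_mul p)

/-- The cellular chain of an edge path: the sum of its edges, with signs according to the direction
in which they are traversed. -/
def SchPath.chain {e : Idem M} {s : M} (hs : s⁻¹ * s = e.1) :
    ∀ {t : M}, SchPath θ s t → C1 θ e
  | _, .nil => 0
  | _, .cons (b := b) p (.inl x) => SchPath.chain hs p +
      FreeAbelianGroup.of ⟨x.1, b, x.2.1, (SchPath.inv_mul p).trans hs⟩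
  | t, .cons p (.inr x) => SchPath.chain hs p -
      FreeAbelianGroup.of ⟨x.1, t, x.2.1, (SchPath.inv_mul (.cons p (.inr x))).trans hs⟩

theorem SchPath.bdry_chain {e : Idem M} {s : M} (hs : s⁻¹ * s = e.1) :
    ∀ {t : M} (p : SchPath θ s t), bdry θ e (p.chain hs) =
      FreeAbelianGroup.of ⟨t, p.inv_mul.trans hs⟩ - FreeAbelianGroup.of ⟨s, hs⟩
  | _, .nil => by
    rw [SchPath.chain, map_zero, sub_self]
  | _, .cons p (.inl x) => by
    change bdry θ e (SchPath.chain hs p +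
      FreeAbelianGroup.of ⟨x.1, _, x.2.1, (SchPath.inv_mul p).trans hs⟩) = _
    rw [map_add, SchPath.bdry_chain hs p, bdry_of]
    have h : ∀ q, Edge.tgt (θ := θ) (e := e) ⟨x.1, _, x.2.1, q⟩ =
      ⟨_, (SchPath.inv_mul (.cons p (.inl x))).trans hs⟩ := fun q => Vert.ext x.2.2
    rw [h]
    simp only [Edge.src]
    abel
  | _, .cons p (.inr x) => by
    change bdry θ e (SchPath.chain hs p - FreeAbelianGroup.of
      ⟨x.1, _, x.2.1, (SchPath.inv_mul (.cons p (.inr x))).trans hs⟩) = _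
    rw [map_sub, SchPath.bdry_chain hs p, bdry_of]
    have h : ∀ q, Edge.tgt (θ := θ) (e := e) ⟨x.1, _, x.2.1, q⟩ =
      ⟨_, (SchPath.inv_mul p).trans hs⟩ := fun q => Vert.ext x.2.2
    rw [h]
    simp only [Edge.src]
    abel

/-- The homology class of a closed edge path. -/
def SchPath.cycle {e : Idem M} (p : SchPath θ e.1 e.1) : H1 θ e :=
  ⟨p.chain (by rw [idem_inv e.2, e.2.eq]), by
    rw [AddMonoidHom.mem_ker, SchPath.bdry_chain, sub_self]⟩

end Presentation

end InvMon

end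

noncomputable section

namespace InvMon

open CategoryTheory

universe u v

variable {X : Type u} {M : Type v} [InverseMonoid M] {θ : FIM X →* M}

/-! In the left Schützenberger graph, reading a letter multiplies the current vertex on the left by
that letter. Hence the reverse of the label of a path from `s` to `t` has an image `p.elem` in `T(M,
X)` with `psi p.elem * s = t`, and for a closed path at `e` the product of `p.elem` and the
idempotent over `e` lies in `K_e`.

This product depends only on the homotopy class. A detour along an edge and back inserts an
idempotent `a⁻¹ a`, which fixes the vertex reached in `M`; since `psi` separates idempotents, it
also fixes every element of `T(M, X)` over that vertex (`SchPath.elem_mul_eq`). Concatenation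
reverses products, so inverting the result gives a homomorphism `π_e → K_e`. It is surjective
because a word that carries `e` back to itself never leaves the L-class on the way, so it can be
read along edges (`exists_path`). It is injective because `θ_min`, unlike the congruence of `θ` in
general, is fine enough for `T(M, X)` to map to the free group: a path with trivial image in `K_e`
has a label that is trivial in the free group. The graph is deterministic, so a path whose label is
not freely reduced backtracks; removing all backtracking leaves an empty label
(`SchPath.exists_reduced`, `SchPath.htpy_eq_one`).

The Hurewicz isomorphism is obtained by closing each edge up with chosen base paths, which defines a
map from chains to the abelianised `π_e`; it restricts on cycles to an inverse of the map sending a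
loop to its chain. For the module structure, right translation keeps labels but moves the base point
from `e` to `e m`. Joining the translated loop to the new base point conjugates its element of `T(M,
X)`, and in an abelianised kernel group conjugation depends only on the image in `M`
(`homologyEquiv_shift`). -/

/-! ### Edge paths -/

/-- The edges from `s` to `t` of the symmetrised left Schützenberger graph. -/
abbrev SchEdge (θ : FIM X →* M) (s t : M) : Type u :=
  {x : X // IsEdge θ x s ∧ θ (FIM.of x) * s = t} ⊕ {x : X // IsEdge θ x t ∧ θ (FIM.of x) * t = s}

/-- The empty path. -/
def SchPath.empty (θ : FIM X →* M) (s : M) : SchPath θ s s := .nil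

/-- The extension of a path by an edge. -/
def SchPath.snoc {s t r : M} (p : SchPath θ s t) (a : SchEdge θ t r) : SchPath θ s r := .cons p a

/-- The path that consists of one edge. -/
def SchEdge.path {s t : M} (a : SchEdge θ s t) : SchPath θ s t := (SchPath.empty θ s).snoc a

/-- The concatenation of two paths. -/
def SchPath.append {s t r : M} (p : SchPath θ s t) (q : SchPath θ t r) : SchPath θ s r :=
  Quiver.Path.comp p q

/-- The reverse of a path. -/
def SchPath.symm {s t : M} (p : SchPath θ s t) : SchPath θ t s := Quiver.Path.reverse p

/-- Vertices are typed in `M` here rather than as objects of the symmetrised quiver, and both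
directions of an edge are one case, so that they are separated only where the direction matters. -/
theorem SchPath.induction {s : M} {motive : ∀ t : M, SchPath θ s t → Prop}
    (empty : motive s (SchPath.empty θ s))
    (snoc : ∀ (t r : M) (p : SchPath θ s t) (a : SchEdge θ t r), motive t p →
      motive r (p.snoc a)) : ∀ {t : M} (p : SchPath θ s t), motive t p
  | _, .nil => empty
  | _, .cons p a => snoc _ _ p a (SchPath.induction empty snoc p)

theorem SchPath.append_empty {s t : M} (p : SchPath θ s t) : p.append (SchPath.empty θ t) = p := rfl

theorem SchPath.append_snoc {s t r r' : M} (p : SchPath θ s t) (q : SchPath θ t r)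
    (a : SchEdge θ r r') : p.append (q.snoc a) = (p.append q).snoc a := rfl

theorem SchPath.snoc_eq_append {s t r : M} (p : SchPath θ s t) (a : SchEdge θ t r) :
    p.snoc a = p.append a.path := rfl

theorem SchPath.symm_empty (s : M) : (SchPath.empty θ s).symm = SchPath.empty θ s := rfl

theorem SchPath.symm_snoc {s t r : M} (p : SchPath θ s t) (a : SchEdge θ t r) :
    (p.snoc a).symm = SchPath.append (SchEdge.path a.swap) p.symm := rfl

/-- The letter that labels an edge of the symmetrised graph. -/
def SchEdge.label {s t : M} : SchEdge θ s t → X ⊕ X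
  | .inl x => Sum.inl x.1
  | .inr x => Sum.inr x.1

theorem SchEdge.label_swap {s t : M} (a : SchEdge θ s t) :
    SchEdge.label a.swap = a.label.swap := by
  cases a <;> rfl

theorem SchPath.word_empty (s : M) : (SchPath.empty θ s).word = 1 := rfl

theorem SchPath.word_snoc {s t r : M} (p : SchPath θ s t) (a : SchEdge θ t r) :
    (p.snoc a).word = p.word * FreeMonoid.of a.label := by
  cases a <;> rfl

/-! ### The element of `T(M, X)` read along a path -/

/-- The image in `T(M, X)` of a letter. -/
def letter (θ : FIM X →* M) (a : X ⊕ X) : TMon θ := tau θ (rho X (FreeMonoid.of a))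

/-- The image in `T(M, X)` of the reverse of the label of a path. -/
def SchPath.elem {s t : M} (p : SchPath θ s t) : TMon θ := tau θ (rho X p.word.reverse)

theorem SchPath.elem_empty (s : M) : (SchPath.empty θ s).elem = 1 := by
  rw [SchPath.elem, SchPath.word_empty]
  exact (congrArg _ (map_one (rho X))).trans (map_one _)

theorem SchPath.elem_snoc {s t r : M} (p : SchPath θ s t) (a : SchEdge θ t r) :
    (p.snoc a).elem = letter θ a.label * p.elem := by
  rw [SchPath.elem, SchPath.word_snoc, FreeMonoid.reverse_mul, map_mul, map_mul]
  rfl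

theorem letter_inr (x : X) : letter θ (.inr x) = (letter θ (.inl x))⁻¹ := rfl

theorem letter_swap (a : X ⊕ X) : letter θ a.swap = (letter θ a)⁻¹ := by
  cases a with
  | inl x => rfl
  | inr x => rw [letter_inr, inv_inv_eq]; rfl

/-- Along an edge labelled `a`, from `s` to `t`, one has `t = a s` and `s = a⁻¹ t`. -/
theorem psi_letter_label {s t : M} (a : SchEdge θ s t) :
    psi θ (letter θ a.label) * s = t ∧ (psi θ (letter θ a.label))⁻¹ * t = s := by
  have key : ∀ {s t : M} (x : {x : X // IsEdge θ x s ∧ θ (FIM.of x) * s = t}),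
      θ (FIM.of x.1) * s = t ∧ (θ (FIM.of x.1))⁻¹ * t = s := by
    rintro s _ ⟨x, h, rfl⟩
    exact ⟨rfl, h.eq⟩
  cases a with
  | inl x => exact key x
  | inr x =>
    have h := key (s := t) (t := s) x
    change psi θ (letter θ (.inr x.1)) * s = t ∧ (psi θ (letter θ (.inr x.1)))⁻¹ * t = s
    rw [letter_inr, map_inv_eq, inv_inv_eq]
    exact h.symm

/-- There is an edge labelled `a` that starts at `s` if `a⁻¹ a s = s`. -/
theorem exists_edge (a : X ⊕ X) (s : M)
    (h : (psi θ (letter θ a))⁻¹ * (psi θ (letter θ a) * s) = s) :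
    ∃ (t : M) (b : SchEdge θ s t), b.label = a := by
  cases a with
  | inl x => exact ⟨_, .inl ⟨x, isEdge_of_eq h, rfl⟩, rfl⟩
  | inr x =>
    rw [letter_inr, map_inv_eq, inv_inv_eq] at h
    refine ⟨(θ (FIM.of x))⁻¹ * s, .inr ⟨x, isEdge_of_eq ?_, h⟩, rfl⟩
    rw [imi_assoc]

/-- Later letters act further to the left; this is why `elem` is built from the reversed label. -/
theorem SchPath.psi_elem {s t : M} (p : SchPath θ s t) : psi θ p.elem * s = t := by
  induction p using SchPath.induction with
  | empty => rw [SchPath.elem_empty, map_one, one_mul]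
  | snoc t r p a ih => rw [SchPath.elem_snoc, map_mul, mul_assoc, ih, (psi_letter_label a).1]

theorem SchPath.elem_append {s t r : M} (p : SchPath θ s t) (q : SchPath θ t r) :
    (p.append q).elem = q.elem * p.elem := by
  induction q using SchPath.induction with
  | empty => rw [SchPath.elem_empty, one_mul, SchPath.append_empty]
  | snoc t r q a ih =>
    rw [SchPath.append_snoc, SchPath.elem_snoc, SchPath.elem_snoc, mul_assoc, ih]

theorem SchEdge.elem_path {s t : M} (a : SchEdge θ s t) : a.path.elem = letter θ a.label := by
  rw [SchEdge.path, SchPath.elem_snoc, SchPath.elem_empty, mul_one]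

theorem SchPath.elem_symm {s t : M} (p : SchPath θ s t) : p.symm.elem = p.elem⁻¹ := by
  induction p using SchPath.induction with
  | empty =>
    rw [SchPath.symm_empty, SchPath.elem_empty, idem_inv (one_mul 1)]
  | snoc t r p a ih =>
    rw [SchPath.symm_snoc, SchPath.elem_append, SchEdge.elem_path, SchEdge.label_swap, letter_swap,
      ih, SchPath.elem_snoc, mul_inv_rev_eq]

/-! ### Homotopy classes of paths -/

/-- A vertex, as an object of the fundamental groupoid. -/
def vtx (θ : FIM X →* M) (s : M) : Quiver.FreeGroupoid (Sch θ) := ⟨s⟩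

/-- The homotopy classes of paths from `s` to `t`. -/
abbrev FundHom (θ : FIM X →* M) (s t : M) : Type (max u v) := vtx θ s ⟶ vtx θ t

/-- The homotopy class of a path. -/
def SchPath.htpy {s t : M} (p : SchPath θ s t) : FundHom θ s t :=
  (CategoryTheory.Quotient.functor (Quiver.FreeGroupoid.redStep (V := Sch θ))).map p

theorem SchPath.htpy_surjective {s t : M} :
    Function.Surjective (SchPath.htpy : SchPath θ s t → _) := Quot.mk_surjective

theorem SchPath.htpy_empty (s : M) : (SchPath.empty θ s).htpy = 𝟙 _ := rfl

theorem SchPath.htpy_append {s t r : M} (p : SchPath θ s t) (q : SchPath θ t r) :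
    (p.append q).htpy = p.htpy ≫ q.htpy := rfl

theorem SchPath.htpy_snoc {s t r : M} (p : SchPath θ s t) (a : SchEdge θ t r) :
    (p.snoc a).htpy = p.htpy ≫ a.path.htpy := rfl

theorem SchPath.htpy_symm {s t : M} (p : SchPath θ s t) :
    p.symm.htpy = (Groupoid.inv p.htpy : FundHom θ t s) := rfl

theorem SchPath.htpy_snoc_swap {s t r : M} (p : SchPath θ s t) (a : SchEdge θ t r) :
    SchPath.htpy ((p.snoc a).snoc a.swap) = p.htpy := by
  have h : (p.snoc a).snoc a.swap = p.append (a.path.append a.path.symm) := rfl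
  rw [h, SchPath.htpy_append, SchPath.htpy_append, SchPath.htpy_symm, Groupoid.comp_inv,
    Category.comp_id]

/-- A function on paths that is invariant under insertion of a subpath that traverses an edge and
returns along it depends only on the homotopy class. -/
theorem SchPath.eq_of_htpy_eq {s t : M} {β : Sort*} (f : SchPath θ s t → β)
    (hf : ∀ (r r' : M) (p : SchPath θ s r) (a : SchEdge θ r r') (q : SchPath θ r t),
      f (p.append ((a.path.append a.path.symm).append q)) = f (p.append q))
    {p q : SchPath θ s t} (h : p.htpy = q.htpy) : f p = f q := by
  -- Morphisms of the groupoid form a `Quot` by single reduction steps in context, so invariance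
  -- under one step is enough for `f` to descend.
  have hf' : ∀ p q : SchPath θ s t, HomRel.CompClosure
      (Quiver.FreeGroupoid.redStep (V := Sch θ)) p q → f p = f q := by
    rintro _ _ ⟨_, _, p, _, _, q, ⟨_, _, a⟩⟩
    refine Eq.trans ?_ (hf _ _ p a q).symm
    congr 1
    exact congrArg (Quiver.Path.comp p) (Quiver.Path.nil_comp q)
  exact congrArg (Quot.lift f hf') h

/-- Homotopic paths from `s` determine the same element of `T(M, X)`, up to multiplication by an
element above `s`. -/
theorem SchPath.elem_mul_eq (hθ : Function.Surjective θ) {s t : M} {p q : SchPath θ s t}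
    (h : p.htpy = q.htpy) {c : TMon θ} (hc : psi θ c = s) : p.elem * c = q.elem * c := by
  refine SchPath.eq_of_htpy_eq (fun p => p.elem * c) ?_ h
  intro r r' p a q
  obtain ⟨h1, h1'⟩ := psi_letter_label a
  have hr : psi θ (p.elem * c) = r := by rw [map_mul, hc, p.psi_elem]
  simp only [SchPath.elem_append, SchPath.elem_symm, SchEdge.elem_path, mul_assoc]
  congr 1
  generalize p.elem * c = d at hr
  -- Both sides are idempotents with the same image in `M`, because `a⁻¹ a` fixes the vertex `r`;
  -- idempotent separation makes them equal.
  have h3 : (letter θ a.label)⁻¹ * letter θ a.label * (d * d⁻¹) = d * d⁻¹ := by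
    refine (psi_isIdemSep hθ).sep _ _ (idem_mul (idem_inv_mul _) (idem_mul_inv _))
      (idem_mul_inv _) ?_
    rw [map_mul, map_mul, map_inv_eq, map_mul _ d, hr, mul_assoc, ← mul_assoc _ r,
      h1, ← mul_assoc, h1']
  have h4 := congrArg (· * d) h3
  simpa only [mul_assoc, mim] using h4

/-! ### Paths with a given label -/

/-- In the L-order `z ≤ y ≤ s`, and `z` and `s` are L-equivalent, so `y` is squeezed into the same
class. Then `a` acts injectively at `y`: there `y⁻¹ a⁻¹ a y = y⁻¹ y`, and `a⁻¹ a` commutes with `y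
y⁻¹`. Thus if a product stays in the L-class, each of its factors acts along an edge. -/
theorem inv_mul_of_mul_inv_mul {s y z a : M} (hz : z = a * y) (hzs : z⁻¹ * z = s⁻¹ * s)
    (hy : y * (s⁻¹ * s) = y) : y⁻¹ * y = s⁻¹ * s ∧ a⁻¹ * (a * y) = y := by
  have h1 : y⁻¹ * y = s⁻¹ * s := by
    have h2 : z⁻¹ * z * (y⁻¹ * y) = z⁻¹ * z := by
      rw [hz]; simp only [mul_assoc, mim]
    have h3 : y⁻¹ * y * (s⁻¹ * s) = y⁻¹ * y := by rw [mul_assoc, hy]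
    rw [← h3, idem_comm (idem_inv_mul y) (idem_inv_mul s), ← hzs, h2]
  refine ⟨h1, ?_⟩
  have h4 : y⁻¹ * (a⁻¹ * (a * y)) = y⁻¹ * y := by
    rw [h1, ← hzs, hz, mul_inv_rev_eq]; simp only [mul_assoc]
  have h5 := congrArg (y * ·) h4
  have h6 := congrArg (· * y) (idem_comm (idem_mul_inv y) (idem_inv_mul a))
  simp only [mul_assoc, mim] at h5 h6
  rw [← h6, h5]

/-- The leftmost letter of `v` acts last, so peeling it off removes the final edge of the path; the
remaining word still keeps `s` in its L-class. -/
theorem exists_path (v : Word X) (s : M)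
    (h : (θ (rho X v) * s)⁻¹ * (θ (rho X v) * s) = s⁻¹ * s) :
    ∃ (t : M) (p : SchPath θ s t), p.word.reverse = v := by
  induction v using FreeMonoid.inductionOn' with
  | one => exact ⟨s, SchPath.empty θ s, rfl⟩
  | of_mul a v ih =>
    have h0 : θ (rho X (FreeMonoid.of a * v)) * s =
        psi θ (letter θ a) * (θ (rho X v) * s) := by
      rw [map_mul, map_mul, mul_assoc]; rfl
    obtain ⟨h1, h2⟩ := inv_mul_of_mul_inv_mul h0 h (by rw [mul_assoc, mim])
    obtain ⟨t, p, hp⟩ := ih h1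
    have ht : θ (rho X v) * s = t := by rw [← hp]; exact p.psi_elem
    rw [ht] at h2
    obtain ⟨r, b, hb⟩ := exists_edge a t h2
    refine ⟨r, p.snoc b, ?_⟩
    rw [SchPath.word_snoc, FreeMonoid.reverse_mul, hp, hb]
    rfl

/-- Any word representing `k` can be read from `e`. This gives both the surjectivity of `kappaHom`
and the connectedness of the component. -/
theorem exists_path_of_mem (e : Idem M) {s : M} (k : TMon θ) (hk : psi θ k * e.1 = s)
    (hs : s⁻¹ * s = e.1) : ∃ p : SchPath θ e.1 s, p.elem = k := by
  obtain ⟨a, rfl⟩ := tau_surjective θ k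
  obtain ⟨v, rfl⟩ := rho_surjective X a
  have h1 : θ (rho X v) * e.1 = s := hk
  obtain ⟨t, p, hp⟩ := exists_path (θ := θ) v e.1 (by rw [h1, hs, idem_inv e.2, e.2.eq])
  have ht : s = t := by rw [← h1, ← hp]; exact p.psi_elem
  subst ht
  exact ⟨p, by rw [SchPath.elem, hp]⟩

/-- There is a path from `e` to every element of its `L`-class. -/
theorem exists_path_to (hθ : Function.Surjective θ) (e : Idem M) {s : M} (hs : s⁻¹ * s = e.1) :
    Nonempty (SchPath θ e.1 s) := by
  obtain ⟨k, hk⟩ := (psi_isIdemSep hθ).surj s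
  obtain ⟨p, -⟩ := exists_path_of_mem e k (by rw [hk, ← hs, mim]) hs
  exact ⟨p⟩

/-! ### Reduced paths -/

/-- The letter of the free group given by a letter of `X ⊔ X⁻¹`. -/
def freeGroupLetter (a : X ⊕ X) : X × Bool := a.elim (fun x => (x, true)) fun x => (x, false)

theorem freeGroupLetter_swap (a : X ⊕ X) :
    freeGroupLetter a.swap = ((freeGroupLetter a).1, !(freeGroupLetter a).2) := by
  cases a <;> rfl

theorem eq_or_swap_of_fst_eq {a b : X ⊕ X} (h : (freeGroupLetter a).1 = (freeGroupLetter b).1) :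
    (freeGroupLetter a).2 = (freeGroupLetter b).2 ∨ b = a.swap := by
  cases a <;> cases b <;> simp_all [freeGroupLetter]

/-- The value of a word in the free group. -/
def wordToFreeGroup (X : Type u) : Word X →* FreeGroup X :=
  FreeMonoid.lift fun a => FreeGroup.mk [freeGroupLetter a]

theorem wordToFreeGroup_eq (w : Word X) :
    wordToFreeGroup X w = FreeGroup.mk (w.toList.map freeGroupLetter) := by
  induction w using FreeMonoid.inductionOn' with
  | one => rfl
  | of_mul a w ih =>
    rw [map_mul, ih, wordToFreeGroup, FreeMonoid.lift_eval_of, FreeGroup.mul_mk]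
    rfl

theorem wordToFreeGroup_winv (w : Word X) :
    wordToFreeGroup X (winv w) = (wordToFreeGroup X w)⁻¹ := by
  induction w using FreeMonoid.inductionOn' with
  | one => exact (map_one (wordToFreeGroup X)).trans (inv_one.symm.trans (congrArg _ (map_one _).symm))
  | of_mul a w ih =>
    rw [winv_mul, map_mul, ih, map_mul, mul_inv_rev]
    congr 1
    change FreeGroup.mk [freeGroupLetter a.swap] = (FreeGroup.mk [freeGroupLetter a])⁻¹
    rw [FreeGroup.inv_mk, freeGroupLetter_swap]
    rfl

/-- The natural map from the free inverse monoid to the free group. -/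
def fimToFreeGroup (X : Type u) : FIM X →* FreeGroup X :=
  Con.lift (wagner X) (wordToFreeGroup X) (Con.conGen_le.2 (by
    intro v w h
    rw [Con.ker_rel]
    cases h <;> simp [wordToFreeGroup_winv]))

/-- The natural map from `T(M, X)` to the free group. -/
def tmonToFreeGroup (θ : FIM X →* M) : TMon θ →* FreeGroup X :=
  Con.lift (thetaMin θ) (fimToFreeGroup X) (by
    -- The choice of `θ_min` enters here: `a f = b f` holds already in `FIM(X)`, and `f` cancels in
    -- a group.
    rintro a b ⟨f, -, h, -⟩
    rw [Con.ker_rel]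
    have := congrArg (fimToFreeGroup X) h
    rw [map_mul, map_mul] at this
    exact mul_right_cancel this)

theorem SchPath.tmonToFreeGroup_elem {s t : M} (p : SchPath θ s t) :
    tmonToFreeGroup θ p.elem = FreeGroup.mk (p.word.reverse.toList.map freeGroupLetter) :=
  wordToFreeGroup_eq _

/-- The Schützenberger graph is deterministic: an edge is determined by its initial vertex and its
label. -/
theorem SchEdge.eq_of_label {s t r : M} (a : SchEdge θ s t) (b : SchEdge θ s r)
    (h : a.label = b.label) : ∃ h : t = r, h ▸ a = b := by
  have htr : t = r := by rw [← (psi_letter_label a).1, h, (psi_letter_label b).1]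
  subst htr
  refine ⟨rfl, ?_⟩
  rcases a with ⟨x, hx⟩ | ⟨x, hx⟩ <;> rcases b with ⟨y, hy⟩ | ⟨y, hy⟩ <;>
    simp_all [SchEdge.label]

/-- Every path is homotopic to a reduced one. -/
theorem SchPath.exists_reduced {s t : M} (p : SchPath θ s t) : ∃ q : SchPath θ s t,
    q.htpy = p.htpy ∧ FreeGroup.IsReduced (q.word.reverse.toList.map freeGroupLetter) := by
  -- In the reversed label a new edge appears at the head of the list, where the recursion for
  -- `FreeGroup.IsReduced` applies.
  have key : ∀ {s t r : M} (q : SchPath θ s t) (a : SchEdge θ t r),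
      (q.snoc a).word.reverse.toList.map freeGroupLetter =
        freeGroupLetter a.label :: q.word.reverse.toList.map freeGroupLetter := by
    intro s t r q a
    rw [SchPath.word_snoc, FreeMonoid.reverse_mul]
    rfl
  induction p using SchPath.induction with
  | empty => exact ⟨SchPath.empty θ s, rfl, FreeGroup.IsReduced.nil⟩
  | snoc t r p a ih =>
    obtain ⟨q, hq, hr⟩ := ih
    have hqa : (q.snoc a).htpy = (p.snoc a).htpy := by
      rw [SchPath.htpy_snoc, SchPath.htpy_snoc, hq]
    by_cases h : FreeGroup.IsReduced ((q.snoc a).word.reverse.toList.map freeGroupLetter)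
    · exact ⟨q.snoc a, hqa, h⟩
    · rw [← hqa]
      clear hqa hq p
      -- Only the last edge of `q` is split off; the inner induction hypothesis is discarded.
      induction q using SchPath.induction with
      | empty =>
        rw [key] at h
        exact absurd FreeGroup.IsReduced.singleton h
      | snoc t' t q b _ =>
        -- As the label of `q.snoc b` is reduced, reducedness can fail only between `b` and `a`, so
        -- `a` and `b` carry inverse labels.
        rw [key, key, FreeGroup.isReduced_cons_cons, ← key, and_iff_left hr] at h
        push Not at h
        have hb : b.label = a.label.swap := (eq_or_swap_of_fst_eq h.1).resolve_left h.2
        -- Determinism turns inverse labels into backtracking: `a` and `b.swap` leave the same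
        -- vertex with the same label.
        obtain ⟨rfl, hab⟩ := SchEdge.eq_of_label a b.swap (by
          rw [SchEdge.label_swap, hb, Sum.swap_swap])
        have hab' : a = b.swap := hab
        rw [hab', SchPath.htpy_snoc_swap]
        rw [key] at hr
        exact ⟨q, rfl, List.IsChain.tail hr⟩

/-- A reduced word that is trivial in the free group is empty. The hypothesis ranges over the
homotopy class because it is applied to a reduced representative. -/
theorem SchPath.htpy_eq_one {s : M} (p : SchPath θ s s)
    (h : ∀ q : SchPath θ s s, q.htpy = p.htpy → tmonToFreeGroup θ q.elem = 1) :
    p.htpy = 𝟙 _ := by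
  obtain ⟨q, hq, hr⟩ := p.exists_reduced
  have h1 := h q hq
  rw [SchPath.tmonToFreeGroup_elem, FreeGroup.one_eq_mk] at h1
  classical
  have h2 := congrArg FreeGroup.toWord h1
  rw [FreeGroup.toWord_mk, FreeGroup.toWord_mk, hr.reduce_eq] at h2
  have key : ∀ {t : M} (q : SchPath θ s t), q.word.reverse.toList.map freeGroupLetter = [] →
      ∃ h : s = t, h ▸ SchPath.empty θ s = q := by
    intro t q hq
    induction q using SchPath.induction with
    | empty => exact ⟨rfl, rfl⟩
    | snoc t r q a _ =>
      rw [SchPath.word_snoc, FreeMonoid.reverse_mul] at hq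
      exact absurd hq (List.cons_ne_nil _ _)
  obtain ⟨_, h3⟩ := key q h2
  rw [← hq, ← h3]
  rfl

/-! ### The isomorphism from the fundamental group to the kernel group -/

variable (hθ : Function.Surjective θ)

/-- The element of `K_e` determined by a closed path at `e`. -/
def SchPath.ker {e : Idem M} (p : SchPath θ e.1 e.1) : KerGroup (psi_isIdemSep hθ) e :=
  ⟨p.elem * (psi_isIdemSep hθ).tilde e, by
    rw [map_mul, (psi_isIdemSep hθ).map_tilde, p.psi_elem]⟩

theorem SchPath.ker_eq_of_htpy {e : Idem M} {p q : SchPath θ e.1 e.1} (h : p.htpy = q.htpy) :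
    p.ker hθ = q.ker hθ :=
  KerGroup.ext (SchPath.elem_mul_eq hθ h ((psi_isIdemSep hθ).map_tilde e))

/-- Left multiplication reverses concatenation, which is why `kappaHom` takes an inverse. -/
theorem SchPath.ker_append {e : Idem M} (p q : SchPath θ e.1 e.1) :
    (p.append q).ker hθ = q.ker hθ * p.ker hθ := by
  apply KerGroup.ext
  rw [KerGroup.mul_val]
  change (p.append q).elem * _ = q.elem * _ * (p.ker hθ).1
  rw [mul_assoc, (psi_isIdemSep hθ).tilde_mul (p.ker hθ).2, SchPath.elem_append, mul_assoc]
  rfl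

theorem SchPath.cls_surjective {e : Idem M} :
    Function.Surjective (SchPath.cls : SchPath θ e.1 e.1 → FundGroup θ e) :=
  SchPath.htpy_surjective

theorem SchPath.cls_append {e : Idem M} (p q : SchPath θ e.1 e.1) :
    SchPath.cls (p.append q) = p.cls * q.cls := rfl

/-- The homomorphism from `π_e` to `K_e`. -/
def kappaHom (e : Idem M) : FundGroup θ e →* KerGroup (psi_isIdemSep hθ) e :=
  MonoidHom.mk' (fun g => (SchPath.ker hθ (SchPath.cls_surjective g).choose)⁻¹) (by
    intro a b
    rw [← mul_inv_rev, ← SchPath.ker_append]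
    congr 1
    apply SchPath.ker_eq_of_htpy
    refine ((SchPath.cls_surjective (a * b)).choose_spec).trans ?_
    refine Eq.trans ?_ (SchPath.cls_append _ _).symm
    rw [(SchPath.cls_surjective a).choose_spec, (SchPath.cls_surjective b).choose_spec])

theorem kappaHom_cls {e : Idem M} (p : SchPath θ e.1 e.1) :
    kappaHom hθ e p.cls = (p.ker hθ)⁻¹ :=
  congrArg (·⁻¹) (SchPath.ker_eq_of_htpy hθ (SchPath.cls_surjective p.cls).choose_spec)

theorem kappaHom_bijective (e : Idem M) : Function.Bijective (kappaHom hθ e) := by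
  constructor
  · rw [injective_iff_map_eq_one]
    intro g hg
    obtain ⟨p, rfl⟩ := SchPath.cls_surjective g
    refine SchPath.htpy_eq_one p fun q hq => ?_
    rw [← show q.cls = p.cls from hq, kappaHom_cls, inv_eq_one] at hg
    -- In the free group the factor coming from the idempotent over `e` cancels, leaving the label
    -- itself trivial.
    have h1 := congrArg (fun k => tmonToFreeGroup θ k.1) hg
    have h2 : (q.ker hθ).1 = q.elem * (psi_isIdemSep hθ).tilde e := rfl
    rw [h2, KerGroup.one_val, map_mul] at h1
    exact mul_eq_right.1 h1
  · intro k
    -- The path is chosen for `k⁻¹` to compensate for the inverse in `kappaHom`.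
    obtain ⟨p, hp⟩ := exists_path_of_mem e (k⁻¹).1 (by rw [(k⁻¹).2, e.2.eq])
      (by rw [idem_inv e.2, e.2.eq])
    refine ⟨p.cls, ?_⟩
    rw [kappaHom_cls, inv_eq_iff_eq_inv]
    apply KerGroup.ext
    change p.elem * _ = _
    rw [hp, (psi_isIdemSep hθ).mul_tilde (k⁻¹).2]

/-- The isomorphism from `π_e` to `K_e`. -/
def kappa (e : Idem M) : FundGroup θ e ≃* KerGroup (psi_isIdemSep hθ) e :=
  MulEquiv.ofBijective (kappaHom hθ e) (kappaHom_bijective hθ e)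

theorem kappa_cls {e : Idem M} (p : SchPath θ e.1 e.1) :
    kappa hθ e p.cls = (p.ker hθ)⁻¹ := kappaHom_cls hθ p

/-! ### The chains of paths -/

/-- The cellular chain of an edge of the symmetrised graph. -/
def SchEdge.chain {e : Idem M} {s t : M} (hs : s⁻¹ * s = e.1) (ht : t⁻¹ * t = e.1) :
    SchEdge θ s t → C1 θ e
  | .inl x => FreeAbelianGroup.of ⟨x.1, s, x.2.1, hs⟩
  | .inr x => -FreeAbelianGroup.of ⟨x.1, t, x.2.1, ht⟩

theorem SchEdge.chain_swap {e : Idem M} {s t : M} (hs : s⁻¹ * s = e.1) (ht : t⁻¹ * t = e.1)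
    (a : SchEdge θ s t) : SchEdge.chain ht hs a.swap = -a.chain hs ht := by
  cases a with
  | inl x => rfl
  | inr x => exact (neg_neg _).symm

theorem SchPath.chain_empty {e : Idem M} {s : M} (hs : s⁻¹ * s = e.1) :
    (SchPath.empty θ s).chain hs = 0 := rfl

theorem SchPath.chain_snoc {e : Idem M} {s t r : M} (hs : s⁻¹ * s = e.1) (p : SchPath θ s t)
    (a : SchEdge θ t r) : (p.snoc a).chain hs =
      p.chain hs + a.chain (p.inv_mul.trans hs) ((p.snoc a).inv_mul.trans hs) := by
  cases a with
  | inl x => rfl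
  | inr x => exact sub_eq_add_neg _ _

theorem SchPath.chain_append {e : Idem M} {s t r : M} (hs : s⁻¹ * s = e.1) (ht : t⁻¹ * t = e.1)
    (p : SchPath θ s t) (q : SchPath θ t r) :
    (p.append q).chain hs = p.chain hs + q.chain ht := by
  induction q using SchPath.induction with
  | empty => rw [SchPath.chain_empty, add_zero, SchPath.append_empty]
  | snoc t r q a ih =>
    rw [SchPath.append_snoc, SchPath.chain_snoc, SchPath.chain_snoc, ih, add_assoc]

theorem SchEdge.chain_path {e : Idem M} {s t : M} (hs : s⁻¹ * s = e.1) (ht : t⁻¹ * t = e.1)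
    (a : SchEdge θ s t) : a.path.chain hs = a.chain hs ht := by
  rw [SchEdge.path, SchPath.chain_snoc, SchPath.chain_empty, zero_add]

theorem SchPath.chain_symm {e : Idem M} {s t : M} (hs : s⁻¹ * s = e.1) (ht : t⁻¹ * t = e.1)
    (p : SchPath θ s t) : p.symm.chain ht = -p.chain hs := by
  induction p using SchPath.induction with
  | empty => rw [SchPath.symm_empty, SchPath.chain_empty, neg_zero]
  | snoc t r p a ih =>
    have ht' := p.inv_mul.trans hs
    rw [SchPath.symm_snoc, SchPath.chain_append ht ht', ih ht', SchEdge.chain_path ht ht',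
      SchEdge.chain_swap ht' ht, SchPath.chain_snoc, neg_add, add_comm]

theorem SchPath.chain_eq_of_htpy {e : Idem M} {s t : M} (hs : s⁻¹ * s = e.1)
    {p q : SchPath θ s t} (h : p.htpy = q.htpy) : p.chain hs = q.chain hs := by
  refine SchPath.eq_of_htpy_eq (fun p => p.chain hs) ?_ h
  intro r r' p a q
  have hr := p.inv_mul.trans hs
  have hr' := (p.snoc a).inv_mul.trans hs
  simp only [SchPath.chain_append hs hr, SchPath.chain_append hr hr, SchPath.chain_append hr hr',
    SchPath.chain_symm hr hr', add_neg_cancel, zero_add]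

theorem idem_inv_mul_self (e : Idem M) : e.1⁻¹ * e.1 = e.1 := by rw [idem_inv e.2, e.2.eq]

theorem SchPath.cycle_val {e : Idem M} (p : SchPath θ e.1 e.1) :
    p.cycle.1 = p.chain (idem_inv_mul_self e) := rfl

/-! ### The Hurewicz isomorphism -/

/-- The homomorphism from `π_e` to the first homology group. -/
def cycleHom (θ : FIM X →* M) (e : Idem M) : FundGroup θ e →* Multiplicative (H1 θ e) :=
  MonoidHom.mk' (fun g => Multiplicative.ofAdd (SchPath.cls_surjective g).choose.cycle) (by
    intro a b
    rw [← ofAdd_add]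
    refine congrArg _ (Subtype.ext ?_)
    rw [AddSubgroup.coe_add, SchPath.cycle_val, SchPath.cycle_val, SchPath.cycle_val,
      ← SchPath.chain_append]
    apply SchPath.chain_eq_of_htpy
    refine ((SchPath.cls_surjective (a * b)).choose_spec).trans ?_
    refine Eq.trans ?_ (SchPath.cls_append _ _).symm
    rw [(SchPath.cls_surjective a).choose_spec, (SchPath.cls_surjective b).choose_spec])

theorem cycleHom_cls {e : Idem M} (p : SchPath θ e.1 e.1) :
    cycleHom θ e p.cls = Multiplicative.ofAdd p.cycle :=
  congrArg Multiplicative.ofAdd (show (SchPath.cls_surjective p.cls).choose.cycle = p.cycle from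
    Subtype.ext (SchPath.chain_eq_of_htpy (idem_inv_mul_self e)
      (SchPath.cls_surjective p.cls).choose_spec))

/-- The abelianised fundamental group, written additively. -/
abbrev FundAb (θ : FIM X →* M) (e : Idem M) : Type (max u v) :=
  Additive (Abelianization (FundGroup θ e))

/-- The class of a closed path in the abelianised fundamental group. -/
def SchPath.ab {e : Idem M} (p : SchPath θ e.1 e.1) : FundAb θ e :=
  Additive.ofMul (Abelianization.of p.cls)

theorem fundAb_induction {e : Idem M} {motive : FundAb θ e → Prop}
    (h : ∀ p : SchPath θ e.1 e.1, motive p.ab) (a : FundAb θ e) : motive a := by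
  obtain ⟨g, hg⟩ := QuotientGroup.mk_surjective (Additive.toMul a)
  obtain ⟨p, rfl⟩ := SchPath.cls_surjective g
  have h1 : p.ab = a := congrArg Additive.ofMul hg
  exact h1 ▸ h p

/-- The homomorphism from the abelianised fundamental group to the first homology group. -/
def abToHomology (θ : FIM X →* M) (e : Idem M) : FundAb θ e →+ H1 θ e :=
  MonoidHom.toAdditiveLeft (Abelianization.lift (cycleHom θ e))

theorem abToHomology_ab {e : Idem M} (p : SchPath θ e.1 e.1) :
    abToHomology θ e p.ab = p.cycle :=
  congrArg Multiplicative.toAdd ((Abelianization.lift_apply_of _ _).trans (cycleHom_cls p))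

/-- A path from `e` to an element of its `L`-class. -/
def basePath (e : Idem M) {s : M} (hs : s⁻¹ * s = e.1) : SchPath θ e.1 s :=
  (exists_path_to hθ e hs).some

/-- The closed path at `e` obtained from a path in the component of `e` by joining its ends
to `e`. -/
def SchPath.loop {e : Idem M} {s t : M} (hs : s⁻¹ * s = e.1) (ht : t⁻¹ * t = e.1)
    (p : SchPath θ s t) : SchPath θ e.1 e.1 :=
  (basePath hθ e hs).append (p.append (basePath hθ e ht).symm)

/-- The base path to the middle vertex is traversed backwards and then forwards, and cancels. -/
theorem SchPath.loop_append {e : Idem M} {s t r : M} (hs : s⁻¹ * s = e.1) (ht : t⁻¹ * t = e.1)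
    (hr : r⁻¹ * r = e.1) (p : SchPath θ s t) (q : SchPath θ t r) :
    ((p.append q).loop hθ hs hr).ab = (p.loop hθ hs ht).ab + (q.loop hθ ht hr).ab := by
  have h : ((p.append q).loop hθ hs hr).cls =
      SchPath.cls ((p.loop hθ hs ht).append (q.loop hθ ht hr)) := by
    change ((p.append q).loop hθ hs hr).htpy =
      SchPath.htpy ((p.loop hθ hs ht).append (q.loop hθ ht hr))
    simp only [SchPath.loop, SchPath.htpy_append, SchPath.htpy_symm, Category.assoc]
    rw [← Category.assoc (Groupoid.inv _), Groupoid.inv_comp, Category.id_comp]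
  rw [SchPath.ab, h, SchPath.cls_append, map_mul]
  rfl

theorem SchPath.loop_symm {e : Idem M} {s t : M} (hs : s⁻¹ * s = e.1) (ht : t⁻¹ * t = e.1)
    (p : SchPath θ s t) : (p.symm.loop hθ ht hs).ab = -(p.loop hθ hs ht).ab := by
  have h0 := SchPath.loop_append hθ ht hs ht p.symm p
  -- The class of the empty path at `t`, closed up, equals its own double and is therefore zero.
  have h1 := SchPath.loop_append hθ ht ht ht (SchPath.empty θ t) (SchPath.empty θ t)
  rw [SchPath.append_empty] at h1
  rw [eq_neg_iff_add_eq_zero, ← h0, ← left_eq_add.1 h1]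
  refine congrArg (fun g => Additive.ofMul (Abelianization.of (G := FundGroup θ e) g)) ?_
  change SchPath.htpy _ = SchPath.htpy _
  simp only [SchPath.loop, SchPath.htpy_append, SchPath.htpy_symm, Groupoid.inv_comp,
    SchPath.htpy_empty]

/-- The chosen base path from `e` to `e` need not be empty, so closing up conjugates by a loop; this
disappears in the abelianisation. -/
theorem SchPath.loop_ab {e : Idem M} (p : SchPath θ e.1 e.1) :
    (p.loop hθ (idem_inv_mul_self e) (idem_inv_mul_self e)).ab = p.ab := by
  let b : SchPath θ e.1 e.1 := basePath hθ e (idem_inv_mul_self e)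
  have h : SchPath.cls (p.loop hθ (idem_inv_mul_self e) (idem_inv_mul_self e)) =
    b.cls * p.cls * (b.cls)⁻¹ := 
      (Category.assoc b.htpy p.htpy (Groupoid.inv b.htpy)).symm
  have h2 : Abelianization.of (b.cls * p.cls * (b.cls)⁻¹) = Abelianization.of p.cls := by
    rw [map_mul, map_mul, map_inv, mul_inv_cancel_comm]
  rw [SchPath.ab, h, h2]
  rfl

/-- An edge, as an edge of the symmetrised graph. -/
def Edge.toSchEdge {e : Idem M} (p : Edge θ e) : SchEdge θ p.src.1 p.tgt.1 :=
  .inl ⟨p.x, p.isEdge, rfl⟩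

/-- The homomorphism from the chain group to the abelianised fundamental group that sends an edge
to the class of the closed path obtained by joining its ends to `e`. -/
def chainToAb (e : Idem M) : C1 θ e →+ FundAb θ e :=
  FreeAbelianGroup.lift fun p => (p.toSchEdge.path.loop hθ p.src.2 p.tgt.2).ab

/-- Both sides are additive under concatenation and change sign under reversal, so everything
reduces to a single forward edge, where it is the definition of `chainToAb`. -/
theorem chainToAb_chain {e : Idem M} {s t : M} (hs : s⁻¹ * s = e.1) (ht : t⁻¹ * t = e.1)
    (p : SchPath θ s t) : chainToAb hθ e (p.chain hs) = (p.loop hθ hs ht).ab := by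
  have key : ∀ {s t : M} (hs : s⁻¹ * s = e.1) (ht : t⁻¹ * t = e.1) (a : SchEdge θ s t),
      chainToAb hθ e (a.chain hs ht) = (a.path.loop hθ hs ht).ab := by
    have h1 : ∀ {s t : M} (hs : s⁻¹ * s = e.1) (ht : t⁻¹ * t = e.1)
        (x : {x : X // IsEdge θ x s ∧ θ (FIM.of x) * s = t}),
        chainToAb hθ e (SchEdge.chain hs ht (.inl x)) =
          ((SchEdge.path (θ := θ) (.inl x)).loop hθ hs ht).ab := by
      rintro s _ hs ht ⟨x, hx, rfl⟩
      exact FreeAbelianGroup.lift_apply_of _ _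
    rintro s t hs ht (x | x)
    · exact h1 hs ht x
    · have h2 := SchEdge.chain_swap (θ := θ) ht hs (.inl x)
      have h3 := SchPath.loop_symm hθ ht hs (SchEdge.path (θ := θ) (.inl x))
      rw [← h1 ht hs x] at h3
      exact (congrArg _ h2).trans ((map_neg _ _).trans h3.symm)
  induction p using SchPath.induction with
  | empty =>
    have h1 := SchPath.loop_append hθ hs ht ht (SchPath.empty θ s) (SchPath.empty θ s)
    rw [SchPath.append_empty] at h1
    rw [SchPath.chain_empty, map_zero, ← left_eq_add.1 h1]
  | snoc t r p a ih =>
    have ht' := p.inv_mul.trans hs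
    rw [SchPath.chain_snoc, map_add, ih ht', key, SchPath.snoc_eq_append,
      SchPath.loop_append hθ hs ht' ht]

theorem chainToAb_cycle {e : Idem M} (p : SchPath θ e.1 e.1) :
    chainToAb hθ e p.cycle.1 = p.ab :=
  (chainToAb_chain hθ _ (idem_inv_mul_self e) p).trans (p.loop_ab hθ)

/-- Closing up an edge adds the base path to its source and subtracts the one to its target. The
error is therefore a function of the boundary and vanishes on cycles. -/
theorem abToHomology_chainToAb {e : Idem M} (c : C1 θ e) :
    (abToHomology θ e (chainToAb hθ e c)).1 = c - FreeAbelianGroup.lift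
      (fun s : Vert e => (basePath hθ e s.2).chain (idem_inv_mul_self e)) (bdry θ e c) := by
  have h : ((bdry θ e).ker.subtype.comp (abToHomology θ e)).comp (chainToAb hθ e) =
      AddMonoidHom.id (C1 θ e) - (FreeAbelianGroup.lift
        (fun s : Vert e => (basePath hθ e s.2).chain (idem_inv_mul_self e))).comp (bdry θ e) := by
    apply FreeAbelianGroup.lift_ext
    intro p
    rw [AddMonoidHom.comp_apply, AddMonoidHom.comp_apply, chainToAb,
      FreeAbelianGroup.lift_apply_of, abToHomology_ab, AddSubgroup.coe_subtype, SchPath.cycle_val,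
      AddMonoidHom.sub_apply, AddMonoidHom.comp_apply, bdry_of, map_sub,
      FreeAbelianGroup.lift_apply_of, FreeAbelianGroup.lift_apply_of, AddMonoidHom.id_apply,
      SchPath.loop, SchPath.chain_append _ p.src.2, SchPath.chain_append _ p.tgt.2,
      SchPath.chain_symm (idem_inv_mul_self e), SchEdge.chain_path _ p.tgt.2]
    have h1 : SchEdge.chain p.src.2 p.tgt.2 p.toSchEdge = FreeAbelianGroup.of p := rfl
    rw [h1]
    abel
  exact DFunLike.congr_fun h c

/-- The first homology group of a component is the abelianisation of its fundamental group. -/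
def hurewicz (e : Idem M) : H1 θ e ≃+ FundAb θ e where
  toFun z := chainToAb hθ e z.1
  invFun := abToHomology θ e
  left_inv z := by
    apply Subtype.ext
    rw [abToHomology_chainToAb, z.2, map_zero, sub_zero]
  right_inv a := by
    induction a using fundAb_induction with
    | h p => rw [abToHomology_ab]; exact chainToAb_cycle hθ p
  map_add' a b := map_add (chainToAb hθ e) _ _

/-- This reduces identities between maps on homology to closed paths, which can be translated edge
by edge. -/
theorem exists_cycle (hθ : Function.Surjective θ) (e : Idem M) (z : H1 θ e) : ∃ p : SchPath θ e.1 e.1, p.cycle = z := by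
  obtain ⟨a, rfl⟩ := (hurewicz hθ e).symm.surjective z
  induction a using fundAb_induction with
  | h p => exact ⟨p, (abToHomology_ab p).symm⟩

/-! ### The isomorphism of modules -/

/-- The isomorphism from the first homology group of a component to the abelianisation
of `K_e`. -/
def homologyEquiv (e : Idem M) : H1 θ e ≃+ KerAb (psi_isIdemSep hθ) e :=
  (hurewicz hθ e).trans (MulEquiv.toAdditive (kappa hθ e).abelianizationCongr)

/-- This allows an arbitrary base point `s` in the component: a translated loop is based at `e m`,
not at the idempotent of its component. -/
theorem homologyEquiv_chain {e : Idem M} {s : M} (hs : s⁻¹ * s = e.1) (p : SchPath θ s s)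
    (z : H1 θ e) (hz : z.1 = p.chain hs) :
    homologyEquiv hθ e z = KerAb.of _ (kappa hθ e (p.loop hθ hs hs).cls) := by
  have h : hurewicz hθ e z = (p.loop hθ hs hs).ab := by
    rw [← chainToAb_chain, ← hz]; rfl
  rw [homologyEquiv, AddEquiv.trans_apply, h]
  rfl

theorem homologyEquiv_cycle {e : Idem M} (p : SchPath θ e.1 e.1) :
    homologyEquiv hθ e p.cycle = KerAb.of _ (kappa hθ e p.cls) := by
  have h : hurewicz hθ e p.cycle = p.ab := chainToAb_cycle hθ p
  rw [homologyEquiv, AddEquiv.trans_apply, h]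
  rfl

/-- Right translation of paths. -/
theorem SchPath.exists_translate {e e' : Idem M} (m : M) (h : e.conj m = e') {s t : M}
    (hs : s⁻¹ * s = e.1) (p : SchPath θ s t) : ∃ q : SchPath θ (s * m) (t * m),
      q.elem = p.elem ∧ q.chain (shift_inv_mul m h hs) =
        FreeAbelianGroup.map (Edge.shift m h) (p.chain hs) := by
  have key : ∀ {s t : M} (hs : s⁻¹ * s = e.1) (ht : t⁻¹ * t = e.1) (a : SchEdge θ s t),
      ∃ b : SchEdge θ (s * m) (t * m), b.label = a.label ∧
        b.chain (shift_inv_mul m h hs) (shift_inv_mul m h ht) =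
          FreeAbelianGroup.map (Edge.shift m h) (a.chain hs ht) := by
    rintro s t hs ht (x | x)
    · refine ⟨.inl ⟨x.1, x.2.1.mul m, by rw [← mul_assoc, x.2.2]⟩, rfl, ?_⟩
      exact (FreeAbelianGroup.map_of_apply (f := Edge.shift m h)
        (⟨x.1, s, x.2.1, hs⟩ : Edge θ e)).symm
    · refine ⟨.inr ⟨x.1, x.2.1.mul m, by rw [← mul_assoc, x.2.2]⟩, rfl, ?_⟩
      exact (congrArg (-·) (FreeAbelianGroup.map_of_apply (f := Edge.shift m h)
        (⟨x.1, t, x.2.1, ht⟩ : Edge θ e)).symm).trans (map_neg _ _).symm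
  induction p using SchPath.induction with
  | empty => exact ⟨SchPath.empty θ _, rfl, (map_zero _).symm⟩
  | snoc t r p a ih =>
    obtain ⟨q, hq, hq'⟩ := ih
    obtain ⟨b, hb, hb'⟩ := key (p.inv_mul.trans hs) ((p.snoc a).inv_mul.trans hs) a
    refine ⟨q.snoc b, ?_, ?_⟩
    · rw [SchPath.elem_snoc, SchPath.elem_snoc, hq, hb]
    · rw [SchPath.chain_snoc, SchPath.chain_snoc, hq', hb', map_add]

/-- The translated loop keeps its label, and joining `e m` to `e'` conjugates the kernel element by
some `g` over `e m`. The action conjugates by some `t` over `m`. Restricted to `K_e`, the latter is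
conjugation by an element that is also over `e m`, so both agree after abelianisation. -/
theorem homologyEquiv_shift {e e' : Idem M} (m : M) (h : e.conj m = e') (z : H1 θ e) :
    homologyEquiv hθ e' (homShift θ m h z) =
      kerShift (psi_isIdemSep hθ) m h (homologyEquiv hθ e z) := by
  obtain ⟨p, rfl⟩ := exists_cycle hθ e z
  obtain ⟨q, hq, hq'⟩ := p.exists_translate m h (idem_inv_mul_self e)
  have hs := shift_inv_mul m h (idem_inv_mul_self e)
  have hsep := psi_isIdemSep hθ
  obtain ⟨t, ht⟩ := hsep.surj m
  set b := basePath hθ e' hs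
  set g := b.elem * hsep.tilde e'
  have hg : psi θ g = e.1 * m := by rw [map_mul, hsep.map_tilde, b.psi_elem]
  have hem : e.conj (e.1 * m) = e' := by rw [Idem.conj_mul, Idem.conj_of_le le_rfl, h]
  have htm : psi θ (hsep.tilde e * t) = e.1 * m := by rw [map_mul, hsep.map_tilde, ht]
  rw [homologyEquiv_chain hθ hs q _ hq'.symm, homologyEquiv_cycle, kappa_cls, kappa_cls,
    kerShift_of _ m h t ht]
  -- Elements of `K_e` absorb the idempotent over `e`, so `t` may be replaced by its product with
  -- that idempotent, which has the same image in `M` as `g`.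
  have h1 : conjHom hsep t (by rw [ht, h]) (p.ker hθ)⁻¹ =
      conjHom hsep (hsep.tilde e * t) (by rw [htm, hem]) (p.ker hθ)⁻¹ := by
    apply KerGroup.ext
    have h2 := hsep.tilde_mul ((p.ker hθ)⁻¹).2
    have h3 := hsep.mul_tilde ((p.ker hθ)⁻¹).2
    rw [conjHom_val, conjHom_val, mul_inv_rev_eq, idem_inv (hsep.tilde_idem e)]
    rw [mul_assoc t⁻¹ (hsep.tilde e), h2, mul_assoc t⁻¹ _ (hsep.tilde e * t), ← mul_assoc _ _ t,
      h3, mul_assoc]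
  -- After the conjugator is exchanged for `g` in the abelianisation, the remaining equality holds
  -- in `K_{e'}` itself.
  rw [h1, conjHom_indep hsep _ g (htm.trans hg.symm) _ (by rw [hg, hem]), map_inv]
  congr 2
  apply KerGroup.ext
  -- In `M` one has `e (e m) = e m`; idempotent separation lifts this to `g` by way of `g g⁻¹`.
  have h2 : hsep.tilde e * g = g := by
    have h3 : hsep.tilde e * (g * g⁻¹) = g * g⁻¹ := by
      refine hsep.sep _ _ (idem_mul (hsep.tilde_idem e) (idem_mul_inv g)) (idem_mul_inv g) ?_
      rw [map_mul, hsep.map_tilde, map_mul, hg, ← mul_assoc, ← mul_assoc, e.2.eq]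
    have h4 := congrArg (· * g) h3
    simpa only [mul_assoc, mim] using h4
  have h5 := hsep.tilde_mul ((q.loop hθ hs hs).ker hθ).2
  have h6 : ((q.loop hθ hs hs).ker hθ).1 = b.elem⁻¹ * (p.elem * g) := by
    change (q.loop hθ hs hs).elem * _ = _
    rw [SchPath.loop, SchPath.elem_append, SchPath.elem_append, SchPath.elem_symm, hq, mul_assoc,
      mul_assoc]
  have h7 : (p.ker hθ).1 = p.elem * hsep.tilde e := rfl
  rw [conjHom_val, h7, ← h5, h6, mul_assoc, mul_assoc, h2, mul_inv_rev_eq,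
    idem_inv (hsep.tilde_idem e'), mul_assoc]

/-- The isomorphism between the homology module and the relation module. -/
def homologyModuleIso : LauschModule.Iso (homologyModule θ) (relationModule hθ) where
  equiv e := homologyEquiv hθ e
  -- In both modules the structure map to `f` is the shift by `f`, so it is covered by the same
  -- compatibility as the action.
  map_res {_ f} h a := homologyEquiv_shift hθ f.1 (Idem.conj_of_le h) a
  map_act e a s := congrArg (Sigma.mk (e.conj s)) (homologyEquiv_shift hθ s rfl a)

end InvMon

end

theorem mainTheorem3 {X : Type*} {M : Type*} [InvMon.InverseMonoid M]
    (R : Set (InvMon.Word X × InvMon.Word X)) (θ : InvMon.FIM X →* M)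
    (hP : InvMon.IsPresentation R θ) :
    ∃ (κ : ∀ e : InvMon.Idem M,
          InvMon.FundGroup θ e ≃* InvMon.KerGroup (InvMon.psi_isIdemSep hP.surj) e)
      (Φ : InvMon.LauschModule.Iso (InvMon.homologyModule θ) (InvMon.relationModule hP.surj)),
      (∀ (e : InvMon.Idem M) (p : InvMon.SchPath θ e.1 e.1),
        (κ e p.cls).1 = (InvMon.tau θ (InvMon.rho X p.word.reverse) *
          (InvMon.psi_isIdemSep hP.surj).tilde e)⁻¹) ∧
      (∀ (e : InvMon.Idem M) (p : InvMon.SchPath θ e.1 e.1),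
        Φ.equiv e p.cycle = InvMon.KerAb.of (InvMon.psi_isIdemSep hP.surj) (κ e p.cls)) := by
  refine ⟨InvMon.kappa hP.surj, InvMon.homologyModuleIso hP.surj, fun e p => ?_, fun e p => ?_⟩
  · rw [InvMon.kappa_cls]
    rfl
  · exact InvMon.homologyEquiv_cycle hP.surj p
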